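/- Let $B_1$ be the open unit disc in $\mathbb R^2$ and let $\mu>-\frac14$. Let $\mathcal H^1_{\mu,0}(B_1)$ be the completion of $C_c^\infty(B_1)$ under the norm $$\|u\|_\mu=\Big(\int_{B_1}\Big(|\nabla u|^2+\mu\,\frac{u^2}{|x|^2(-\ln|x|)^2}\Big)\,dx\Big)^{1/2},$$ regarded as a space of (classes of) functions in $L^2(B_1)$, and let $\mathcal H^1_{\mathrm{rad},\mu,0}(B_1)$ be the set of its radially symmetric elements. Then $$\sup_{u\in\mathcal H^1_{\mathrm{rad},\mu,0}(B_1),\ \|u\|_\mu\le 1}\ \int_{B_1}e^{4\pi\sqrt{1+4\mu}\;u^2}\,dx<\infty,$$ and for every $\alpha>4\pi\sqrt{1+4\mu}$, $$\sup_{u\in\mathcal H^1_{\mathrm{rad},\mu,0}(B_1),\ \|u\|_\mu\le 1}\ \int_{B_1}e^{\alpha u^2}\,dx=\infty.$$ -/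

import Mathlib

open MeasureTheory Set Filter Topology
open scoped ENNReal Distributions Gradient

/-- The Euclidean plane. -/
abbrev Plane : Type := EuclideanSpace ℝ (Fin 2)

/-- The open unit disc `B₁` of the plane. -/
def unitDisc : TopologicalSpace.Opens Plane := ⟨Metric.ball 0 1, Metric.isOpen_ball⟩

/-- Lebesgue measure on `B₁`. -/
noncomputable def discMeasure : Measure Plane := volume.restrict (Metric.ball (0 : Plane) 1)

/-- For `φ ∈ C_c^∞(B₁)`,
`‖φ‖_μ = (∫_{B₁} |∇φ|² + μ φ² / (|x|² (-ln |x|)²) dx)^{1/2}`.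
(For test functions the integrand is always integrable, and by Leray's inequality the integral
is nonnegative when `μ ≥ -1/4`.) -/
noncomputable def testNorm (μ : ℝ) (φ : 𝓓(unitDisc, ℝ)) : ℝ :=
  Real.sqrt (∫ x, (‖(∇ φ : Plane → Plane) x‖ ^ 2
    + μ * (φ x ^ 2 / (‖x‖ ^ 2 * (-Real.log ‖x‖) ^ 2))) ∂discMeasure)

/-- `φ` is a Cauchy sequence in `(C_c^∞(B₁), ‖·‖_μ)`. -/
def IsCauchyTestSeq (μ : ℝ) (φ : ℕ → 𝓓(unitDisc, ℝ)) : Prop :=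
  ∀ ε : ℝ, 0 < ε → ∃ N : ℕ, ∀ m n : ℕ, N ≤ m → N ≤ n → testNorm μ (φ m - φ n) < ε

/-- The `‖·‖_μ`-Cauchy sequence `φ` of test functions represents the function `u`: it converges
to `u` in `L²(B₁)`. For `μ > -1/4` every `‖·‖_μ`-Cauchy sequence represents exactly one
`u ∈ L²(B₁)`, and two of them represent the same `u` iff their difference tends to `0` in
`‖·‖_μ`; this is how the completion of `C_c^∞(B₁)` is a space of (classes of) functions. -/
def Represents (μ : ℝ) (φ : ℕ → 𝓓(unitDisc, ℝ)) (u : Lp ℝ 2 discMeasure) : Prop :=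
  IsCauchyTestSeq μ φ ∧
    Tendsto (fun n => eLpNorm (fun x => φ n x - u x) 2 discMeasure) atTop (𝓝 0)

/-- `H¹_{μ,0}(B₁)`: the completion of `C_c^∞(B₁)` under `‖·‖_μ`, realized in `L²(B₁)`. -/
def leraySpace (μ : ℝ) : Set (Lp ℝ 2 discMeasure) := {u | ∃ φ, Represents μ φ u}

/-- The norm `‖u‖_μ` of the completion: the limit of `‖φ n‖_μ` for a Cauchy sequence `φ` of test
functions representing `u`. The limit is the same for all of them, so that the set below has
exactly one element for `u ∈ H¹_{μ,0}(B₁)`, `μ > -1/4`; the infimum only picks that element. -/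
noncomputable def lerayNorm (μ : ℝ) (u : Lp ℝ 2 discMeasure) : ℝ :=
  sInf {c : ℝ | ∃ φ, Represents μ φ u ∧ Tendsto (fun n => testNorm μ (φ n)) atTop (𝓝 c)}

/-- `u` is radially symmetric: `u(x) = f(|x|)` for almost every `x ∈ B₁`. -/
def IsRadial (u : Lp ℝ 2 discMeasure) : Prop :=
  ∃ f : ℝ → ℝ, Measurable f ∧ ∀ᵐ x ∂discMeasure, u x = f ‖x‖

/-- `H¹_{rad,μ,0}(B₁)`: the radially symmetric elements of `H¹_{μ,0}(B₁)`. -/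
def radialLeraySpace (μ : ℝ) : Set (Lp ℝ 2 discMeasure) := {u | u ∈ leraySpace μ ∧ IsRadial u}

/-- `∫_{B₁} e^{α u²} dx ∈ [0, ∞]`. -/
noncomputable def expIntegral (α : ℝ) (u : Lp ℝ 2 discMeasure) : ℝ≥0∞ :=
  ∫⁻ x, ENNReal.ofReal (Real.exp (α * u x ^ 2)) ∂discMeasure

/-! Put x = e^{-s}θ and ν = √(1+4μ). Then dx = e^{-2s} ds dθ, and a radial function becomes w(s)
with squared norm 2π ∫ (w'² + μ w²/s²) ds over (0, ∞). The ground state substitution w = s^{(1-ν)/2}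
h(s^ν) turns this into 2πν ∫ h'² dt. With g = √(2πν) w the critical integral is 2π ∫ e^{2(g² - s)}
ds, so the problem becomes Moser's one-dimensional inequality.

Critical case. Norm at most 1 forces g² ≤ s, which alone does not bound the integral. Prescribing g
at two points costs the energy `twoPointEnergy`, and if g² is within l of s at both points, a total
energy of at most 1 forces them to be O(l) apart, unless the first lies below 8l. Hence {s - g² ≤ l}
has measure O(l) (`exists_measurableSet_superset_sublevel`), and summing over integer levels bounds
the integral. The energy bound comes from a calibration (`twoPointEnergy_le_integral`).

Elements of the completion are only L² limits of test functions that need not be radial. The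
two-point bound needs no regularity of the limit: Fatou's lemma over the directions θ yields one ray
whose limiting energy is at most the average and along which the approximants converge almost
everywhere (`exists_ray_twoPointEnergy_le`).

Supercritical case. Smooth h close to min(t, 1), descending very slowly to zero, nearly attain g² =
s at s = 1. The dilations √T w(s/T) preserve the energy, keep the exponent αw² - 2s positive on an
interval of length proportional to T, and so make the integral unbounded. -/

/-! ### Logarithmic polar coordinates. -/

/-- The measure `e^{-2s} ds` on `(0, ∞)`. -/
noncomputable def expMeasure : Measure ℝ :=
  (volume.restrict (Ioi 0)).withDensity fun s => ENNReal.ofReal (Real.exp (-2 * s))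

instance : SigmaFinite expMeasure := by
  unfold expMeasure
  exact SigmaFinite.withDensity_ofReal _

lemma lintegral_expMeasure (f : ℝ → ℝ≥0∞) (hf : Measurable f) :
    ∫⁻ s, f s ∂expMeasure = ∫⁻ s in Ioi 0, ENNReal.ofReal (Real.exp (-2 * s)) * f s := by
  unfold expMeasure
  rw [lintegral_withDensity_eq_lintegral_mul _ (by fun_prop) hf]
  rfl

lemma integral_expMeasure (f : ℝ → ℝ) :
    ∫ s, f s ∂expMeasure = ∫ s in Ioi 0, Real.exp (-2 * s) * f s := by
  unfold expMeasure
  rw [integral_withDensity_eq_integral_toReal_smul (by fun_prop) (by simp)]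
  simp [ENNReal.toReal_ofReal (Real.exp_nonneg _)]

lemma integrable_expMeasure_iff (f : ℝ → ℝ) :
    Integrable f expMeasure ↔ IntegrableOn (fun s => Real.exp (-2 * s) * f s) (Ioi 0) := by
  unfold expMeasure
  rw [integrable_withDensity_iff_integrable_smul' (by fun_prop) (by simp)]
  simp [ENNReal.toReal_ofReal (Real.exp_nonneg _), IntegrableOn]

lemma ae_expMeasure_iff {p : ℝ → Prop} :
    (∀ᵐ s ∂expMeasure, p s) ↔ ∀ᵐ s ∂(volume.restrict (Ioi 0) : Measure ℝ), p s := by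
  unfold expMeasure
  rw [ae_withDensity_iff (by fun_prop)]
  simp [Real.exp_pos]

/-- The uniform measure of mass `2π` on the unit circle. -/
noncomputable abbrev circleMeasure : Measure (Metric.sphere (0 : Plane) 1) :=
  (volume : Measure Plane).toSphere

lemma circleMeasure_univ : circleMeasure univ = ENNReal.ofReal (2 * Real.pi) := by
  rw [Measure.toSphere_apply_univ, EuclideanSpace.volume_ball_fin_two]
  simp [ENNReal.ofReal_mul]

/-- Logarithmic polar coordinates on the punctured disc. -/
noncomputable def logPolar (p : Metric.sphere (0 : Plane) 1 × ℝ) : Plane :=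
  Real.exp (-p.2) • (p.1 : Plane)

lemma continuous_logPolar : Continuous logPolar := by
  unfold logPolar
  fun_prop

@[simp] lemma norm_logPolar (p : Metric.sphere (0 : Plane) 1 × ℝ) :
    ‖logPolar p‖ = Real.exp (-p.2) := by
  simp [logPolar, norm_smul]

lemma lintegral_polar (F : Plane → ℝ≥0∞) (hF : Measurable F) :
    ∫⁻ x, F x = ∫⁻ θ, ∫⁻ r in Ioi (0 : ℝ), ENNReal.ofReal r * F (r • (θ : Plane))
      ∂volume ∂circleMeasure := by
  have h1 := (volume : Measure Plane).measurePreserving_homeomorphUnitSphereProd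
  have hfr : Module.finrank ℝ Plane - 1 = 1 := by simp
  rw [hfr] at h1
  calc ∫⁻ x, F x = ∫⁻ x : ({(0)}ᶜ : Set Plane), F (x : Plane) ∂((volume : Measure Plane).comap Subtype.val) := by
        rw [lintegral_subtype_comap (measurableSet_singleton _).compl, restrict_compl_singleton]
    _ = ∫⁻ p, F ((p.2 : ℝ) • (p.1 : Plane)) ∂(circleMeasure.prod (Measure.volumeIoiPow 1)) := by
        rw [← h1.lintegral_comp_emb (Homeomorph.measurableEmbedding _)]
        refine lintegral_congr fun x => ?_
        congr 1
        have : ‖(x : Plane)‖ ≠ 0 := norm_ne_zero_iff.2 x.2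
        simp [smul_smul, this]
    _ = ∫⁻ θ, ∫⁻ r, F ((r : ℝ) • (θ : Plane)) ∂(Measure.volumeIoiPow 1) ∂circleMeasure := by
        rw [lintegral_prod _ (by fun_prop)]
    _ = _ := by
        refine lintegral_congr fun θ => ?_
        rw [Measure.volumeIoiPow, lintegral_withDensity_eq_lintegral_mul _ (by fun_prop)
          (by fun_prop), ← lintegral_subtype_comap measurableSet_Ioi]
        simp

lemma lintegral_disc (F : Plane → ℝ≥0∞) (hF : Measurable F) :
    ∫⁻ x, F x ∂discMeasure = ∫⁻ θ, ∫⁻ s, F (logPolar (θ, s)) ∂expMeasure ∂circleMeasure := by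
  rw [discMeasure, ← lintegral_indicator Metric.isOpen_ball.measurableSet,
    lintegral_polar _ (hF.indicator Metric.isOpen_ball.measurableSet)]
  refine lintegral_congr fun θ => ?_
  have himg : (fun s : ℝ => Real.exp (-s)) '' Ioi 0 = Ioo 0 1 := by
    ext r
    constructor
    · rintro ⟨s, hs, rfl⟩
      exact ⟨Real.exp_pos _, by simpa using hs⟩
    · rintro ⟨h0, h1⟩
      exact ⟨-Real.log r, by simpa using Real.log_neg h0 h1, by simp [Real.exp_log h0]⟩
  have hm : Measurable fun s => F (logPolar (θ, s)) :=
    hF.comp (continuous_logPolar.measurable.comp (by fun_prop))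
  calc ∫⁻ r in Ioi (0 : ℝ), ENNReal.ofReal r *
        (Metric.ball (0 : Plane) 1).indicator F (r • (θ : Plane))
      = ∫⁻ r in Ioi (0 : ℝ), (Ioo (0 : ℝ) 1).indicator
          (fun r => ENNReal.ofReal r * F (r • (θ : Plane))) r := by
        refine setLIntegral_congr_fun measurableSet_Ioi fun r (hr : 0 < r) => ?_
        by_cases h : r < 1 <;>
          simp [indicator, hr, norm_smul, abs_of_pos hr, h]
    _ = ∫⁻ r in Ioo (0 : ℝ) 1, ENNReal.ofReal r * F (r • (θ : Plane)) := by
        rw [lintegral_indicator measurableSet_Ioo, Measure.restrict_restrict measurableSet_Ioo,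
          inter_eq_left.2 Ioo_subset_Ioi_self]
    _ = ∫⁻ s in Ioi (0 : ℝ), ENNReal.ofReal |-Real.exp (-s)| *
          (ENNReal.ofReal (Real.exp (-s)) * F (Real.exp (-s) • (θ : Plane))) := by
        rw [← himg]
        refine lintegral_image_eq_lintegral_abs_deriv_mul measurableSet_Ioi
          (fun s _ => ?_) ?_ _
        · have := ((hasDerivAt_id s).neg.exp).hasDerivWithinAt (s := Ioi 0)
          simpa using this
        · intro a _ b _ hab
          simpa using hab
    -- One factor e^{-s} is the polar weight r, the other the Jacobian of r = e^{-s}.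
    _ = _ := by
        rw [lintegral_expMeasure _ hm]
        refine lintegral_congr fun s => ?_
        rw [← mul_assoc, abs_neg, abs_of_pos (Real.exp_pos _),
          ← ENNReal.ofReal_mul (Real.exp_nonneg _), ← Real.exp_add]
        simp only [logPolar]
        ring_nf

theorem map_logPolar : (circleMeasure.prod expMeasure).map logPolar = discMeasure := by
  refine Measure.ext_of_lintegral _ fun F hF => ?_
  rw [lintegral_map hF continuous_logPolar.measurable,
    lintegral_prod (fun a => F (logPolar a)) (hF.comp continuous_logPolar.measurable).aemeasurable,
    lintegral_disc F hF]

/-! ### Calibration: a lower bound for the energy in terms of two values. -/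

/-- `t ↦ g² / t` at `s` plus the least energy needed to join the values `g s`, `g t` of a function
after the ground state transformation `h = g t^{-(1-ν)/2}`. -/
noncomputable def twoPointEnergy (ν : ℝ) (g : ℝ → ℝ) (s t : ℝ) : ℝ :=
  g s ^ 2 / s + (g t * t ^ (-((1 - ν) / 2)) - g s * s ^ (-((1 - ν) / 2))) ^ 2 / (t ^ ν - s ^ ν)

section OneDimensional

variable {w w' G : ℝ → ℝ} {m : ℝ}

/-- Completing the square: the energy density minus the derivative of the calibration is (w' - a w/s
- k s^{-a})². The parameter k is the slope of a competitor in the variable s^{1-2a}. -/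
lemma calibration_sub_le_integral (a k : ℝ) (ha : 1 - 2 * a ≠ 0)
    (hw : ∀ s, HasDerivAt w (w' s) s) (hG : IntegrableOn G (Ioi 0))
    (hle : ∀ s, 0 < s → w' s ^ 2 + a * (a - 1) * (w s ^ 2 / s ^ 2) ≤ G s)
    {x y : ℝ} (hx : 0 < x) (hxy : x ≤ y) :
    (a * (w y ^ 2 / y) + 2 * k * (w y * y ^ (-a)) - k ^ 2 * (y ^ (1 - 2 * a) / (1 - 2 * a))) -
      (a * (w x ^ 2 / x) + 2 * k * (w x * x ^ (-a)) - k ^ 2 * (x ^ (1 - 2 * a) / (1 - 2 * a)))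
      ≤ ∫ s in x..y, G s := by
  have hd : ∀ s, 0 < s → HasDerivAt
      (fun s => a * (w s ^ 2 / s) + 2 * k * (w s * s ^ (-a))
        - k ^ 2 * (s ^ (1 - 2 * a) / (1 - 2 * a)))
      (a * ((2 * w s * w' s * s - w s ^ 2) / s ^ 2)
        + 2 * k * (w' s * s ^ (-a) + w s * (-a * s ^ (-a - 1)))
        - k ^ 2 * s ^ (-(2 * a))) s := by
    intro s hs
    have h1 := ((hw s).pow 2).div (hasDerivAt_id s) hs.ne'
    have h2 := (hw s).mul (Real.hasDerivAt_rpow_const (x := s) (p := -a) (Or.inl hs.ne'))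
    have h3 := (Real.hasDerivAt_rpow_const (x := s) (p := 1 - 2 * a) (Or.inl hs.ne')).div_const
      (1 - 2 * a)
    have h4 := ((h1.const_mul a).add (h2.const_mul (2 * k))).sub (h3.const_mul (k ^ 2))
    refine h4.congr_deriv ?_
    rw [mul_div_cancel_left₀ _ ha, show 1 - 2 * a - 1 = -(2 * a) by ring]
    simp
  refine intervalIntegral.sub_le_integral_of_hasDeriv_right_of_le hxy
    (fun s hs => (hd s (hx.trans_le hs.1)).continuousAt.continuousWithinAt)
    (fun s hs => (hd s (hx.trans hs.1)).hasDerivWithinAt)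
    (hG.mono_set fun s hs => hx.trans_le hs.1) fun s hs => ?_
  have hs0 : 0 < s := hx.trans hs.1
  refine le_trans ?_ (hle s hs0)
  have e1 : s ^ (-a - 1) = s ^ (-a) / s := Real.rpow_sub_one hs0.ne' _
  have e2 : s ^ (-(2 * a)) = s ^ (-a) * s ^ (-a) := by
    rw [← Real.rpow_add hs0]; ring_nf
  rw [e1, e2, ← sub_nonneg]
  have : w' s ^ 2 + a * (a - 1) * (w s ^ 2 / s ^ 2) -
      (a * ((2 * w s * w' s * s - w s ^ 2) / s ^ 2) +
        2 * k * (w' s * s ^ (-a) + w s * (-a * (s ^ (-a) / s))) - k ^ 2 * (s ^ (-a) * s ^ (-a)))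
      = (w' s - a * w s / s - k * s ^ (-a)) ^ 2 := by
    field_simp
    ring
  rw [this]
  positivity

/-- Three calibrations are glued: exponent (1+ν)/2 before t₁, then (1-ν)/2 with the optimal slope
between t₁ and t₂, then (1-ν)/2 with slope zero. The jump of exponent at t₁ leaves ν w(t₁)²/t₁, the
terms at t₂ cancel, and the boundary term at infinity vanishes because w is bounded. -/
theorem twoPointEnergy_le_integral {ν : ℝ} (hν : 0 < ν)
    (hw : ∀ s, HasDerivAt w (w' s) s) {s₀ : ℝ} (hs₀ : 0 < s₀) (hw₀ : ∀ s ≤ s₀, w s = 0)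
    (hwm : ∀ s, |w s| ≤ m) (hG : IntegrableOn G (Ioi 0))
    (hle : ∀ s, 0 < s → w' s ^ 2 + (ν ^ 2 - 1) / 4 * (w s ^ 2 / s ^ 2) ≤ G s)
    {t₁ t₂ : ℝ} (ht₁ : 0 < t₁) (ht : t₁ < t₂) :
    ν * twoPointEnergy ν w t₁ t₂ ≤ ∫ s in Ioi 0, G s := by
  -- Both b and 1 - b solve a(a - 1) = (ν² - 1)/4.
  set b := (1 - ν) / 2 with hb
  have hb1 : 1 - 2 * b = ν := by rw [hb]; ring
  have hleb : ∀ s, 0 < s → w' s ^ 2 + b * (b - 1) * (w s ^ 2 / s ^ 2) ≤ G s := by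
    intro s hs
    convert hle s hs using 3
    rw [hb]; ring
  have hlea : ∀ s, 0 < s → w' s ^ 2 + (1 - b) * ((1 - b) - 1) * (w s ^ 2 / s ^ 2) ≤ G s := by
    intro s hs
    convert hleb s hs using 3
    ring
  have ii : ∀ x y : ℝ, 0 ≤ x → 0 ≤ y → IntervalIntegrable G volume x y := fun x y hx hy =>
    ⟨hG.mono_set fun s hs => hx.trans_lt hs.1, hG.mono_set fun s hs => hy.trans_lt hs.1⟩
  have hD : 0 < t₂ ^ ν - t₁ ^ ν := sub_pos.2 (Real.rpow_lt_rpow ht₁.le ht hν)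
  -- Starting where w still vanishes removes the boundary term at 0.
  set x := min s₀ t₁
  have hx : 0 < x := lt_min hs₀ ht₁
  have p0 : 0 ≤ ∫ s in (0 : ℝ)..x, G s := by
    rw [intervalIntegral.integral_of_le hx.le]
    refine setIntegral_nonneg measurableSet_Ioc fun s hs => ?_
    have := hle s hs.1
    rw [hw₀ s (hs.2.trans (min_le_left _ _))] at this
    simp only [ne_eq, OfNat.ofNat_ne_zero, not_false_eq_true, zero_pow, zero_div, mul_zero,
      add_zero] at this
    exact (sq_nonneg _).trans this
  have p1 := calibration_sub_le_integral (1 - b) 0 (by rw [← hb1] at hν; linarith) hw hG hlea hx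
    (min_le_right s₀ t₁)
  rw [hw₀ x (min_le_left _ _)] at p1
  -- This slope maximizes the lower bound, which is quadratic in k.
  set k := ν * (w t₂ * t₂ ^ (-b) - w t₁ * t₁ ^ (-b)) / (t₂ ^ ν - t₁ ^ ν) with hk
  have p2 := calibration_sub_le_integral b k (by rw [hb1]; exact hν.ne') hw hG hleb ht₁ ht.le
  rw [hb1] at p2
  have key : ∀ T, t₂ ≤ T → ν * twoPointEnergy ν w t₁ t₂ - |b| * (m ^ 2 / T)
      ≤ ∫ s in (0 : ℝ)..T, G s := by
    intro T hT
    have hT0 : 0 < T := (ht₁.trans ht).trans_le hT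
    have p3 := calibration_sub_le_integral b 0 (by rw [hb1]; exact hν.ne') hw hG hleb
      (ht₁.trans ht) hT
    have hsum : ∫ s in (0 : ℝ)..T, G s = (∫ s in (0 : ℝ)..x, G s) + (∫ s in x..t₁, G s)
        + (∫ s in t₁..t₂, G s) + ∫ s in t₂..T, G s := by
      rw [intervalIntegral.integral_add_adjacent_intervals (ii _ _ le_rfl hx.le)
        (ii _ _ hx.le ht₁.le), intervalIntegral.integral_add_adjacent_intervals
        (ii _ _ le_rfl ht₁.le) (ii _ _ ht₁.le (ht₁.trans ht).le),
        intervalIntegral.integral_add_adjacent_intervals (ii _ _ le_rfl (ht₁.trans ht).le)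
        (ii _ _ (ht₁.trans ht).le hT0.le)]
    have hbw : -(|b| * (m ^ 2 / T)) ≤ b * (w T ^ 2 / T) := by
      have h1 : |b * (w T ^ 2 / T)| ≤ |b| * (m ^ 2 / T) := by
        rw [abs_mul, abs_of_nonneg (by positivity : 0 ≤ w T ^ 2 / T)]
        have : w T ^ 2 ≤ m ^ 2 := sq_le_sq.2 ((hwm T).trans (le_abs_self m))
        gcongr
      exact (abs_le.1 h1).1
    have hE : ν * twoPointEnergy ν w t₁ t₂ = ν * (w t₁ ^ 2 / t₁)
        + (2 * k * (w t₂ * t₂ ^ (-b)) - k ^ 2 * (t₂ ^ ν / ν))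
        - (2 * k * (w t₁ * t₁ ^ (-b)) - k ^ 2 * (t₁ ^ ν / ν)) := by
      rw [twoPointEnergy, hk, ← hb]
      field_simp
      ring
    have hb2 : ν * (w t₁ ^ 2 / t₁) = (1 - b) * (w t₁ ^ 2 / t₁) - b * (w t₁ ^ 2 / t₁) := by
      rw [← hb1]; ring
    simp only [mul_zero, zero_mul, add_zero, sub_zero, ne_eq, OfNat.ofNat_ne_zero,
      not_false_eq_true, zero_pow, zero_div] at p1 p3
    linarith
  have hl : Tendsto (fun T : ℝ => ν * twoPointEnergy ν w t₁ t₂ - |b| * (m ^ 2 / T)) atTop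
      (𝓝 (ν * twoPointEnergy ν w t₁ t₂ - |b| * 0)) :=
    (tendsto_const_nhds.div_atTop tendsto_id).const_mul _ |>.const_sub _
  rw [mul_zero, sub_zero] at hl
  exact le_of_tendsto_of_tendsto hl (intervalIntegral_tendsto_integral_Ioi 0 hG tendsto_id)
    ((eventually_ge_atTop t₂).mono key)

end OneDimensional

/-! ### Sublevel sets and the one-dimensional exponential inequality. -/

/-- With Z = Y - X the hypothesis reduces to Z²((1-ε)² - ε) ≤ 4εXZ. For ε ≤ 1/8 the bracket is at
least 1/2, whence Z ≤ 8εX. -/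
lemma le_of_sq_sub_le {X Y p q ε : ℝ} (hX : 0 < X) (hXY : X ≤ Y) (hp : p ≤ 1)
    (hq : 1 - ε ≤ q) (hε : 0 < ε) (hε' : ε ≤ 1 / 8)
    (h : (q * Y - p * X) ^ 2 ≤ ε * (Y ^ 2 - X ^ 2)) : Y ≤ (1 + 8 * ε) * X := by
  by_contra! hcon
  have hY : 0 < Y := hX.trans_le hXY
  rcases le_or_gt ((1 - ε) * Y) X with h1 | h1
  · nlinarith [mul_pos hε hX, mul_pos hε (mul_pos hε hX)]
  · have h2 : (1 - ε) * Y - X ≤ q * Y - p * X := by nlinarith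
    have h3 : ((1 - ε) * Y - X) ^ 2 ≤ ε * (Y ^ 2 - X ^ 2) :=
      (pow_le_pow_left₀ (by linarith) h2 2).trans h
    obtain ⟨Z, rfl⟩ : ∃ Z, Y = X + Z := ⟨Y - X, by ring⟩
    have hZ : 8 * (ε * X) < Z := by linarith
    have hεX := mul_pos hε hX
    have hZ0 : 0 < Z := by linarith
    have h4 : Z ^ 2 * ((1 - ε) ^ 2 - ε) ≤ 4 * (ε * X) * Z := by
      nlinarith [mul_pos hεX hZ0, mul_pos hε (mul_pos hεX hZ0), sq_nonneg (ε * X)]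
    have h5 : (1 : ℝ) / 2 ≤ (1 - ε) ^ 2 - ε := by nlinarith
    nlinarith [mul_pos hZ0 hZ0, mul_le_mul_of_nonneg_left h5 (sq_nonneg Z)]

/-- Set ε = l/t₁, p = |g(t₁)|/√t₁, q = |g(t₂)|/√t₂, X = t₁^{ν/2}, Y = t₂^{ν/2}. The first term p²
already uses at least 1 - ε of the energy, so (qY - pX)² ≤ ε(Y² - X²). Thus Y/X is at most 1 + 8ε,
and t₂/t₁ at most e^{16ε/ν}. -/
lemma sub_le_of_twoPointEnergy_le_one {ν : ℝ} (hν : 0 < ν) {g : ℝ → ℝ} {t₁ t₂ l : ℝ}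
    (ht₁ : 0 < t₁) (ht : t₁ < t₂) (hl : 0 < l) (hl₁ : 8 * l ≤ t₁)
    (h₁ : t₁ - g t₁ ^ 2 ≤ l) (h₂ : t₂ - g t₂ ^ 2 ≤ l)
    (h : twoPointEnergy ν g t₁ t₂ ≤ 1) :
    t₂ - t₁ ≤ 16 / ν * Real.exp (2 / ν) * l := by
  have ht₂ : 0 < t₂ := ht₁.trans ht
  set X := t₁ ^ (ν / 2)
  set Y := t₂ ^ (ν / 2)
  have hX : 0 < X := Real.rpow_pos_of_pos ht₁ _
  have hY : 0 < Y := Real.rpow_pos_of_pos ht₂ _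
  have hX2 : t₁ ^ ν = X ^ 2 := by
    rw [← Real.rpow_natCast, ← Real.rpow_mul ht₁.le]; norm_num
  have hY2 : t₂ ^ ν = Y ^ 2 := by
    rw [← Real.rpow_natCast, ← Real.rpow_mul ht₂.le]; norm_num
  have hXY : X < Y := Real.rpow_lt_rpow ht₁.le ht (by positivity)
  have hb : ∀ t : ℝ, 0 < t → t ^ (-((1 - ν) / 2)) = t ^ (ν / 2) / Real.sqrt t := by
    intro t ht
    rw [Real.sqrt_eq_rpow, ← Real.rpow_sub ht]; ring_nf
  have hD : 0 < Y ^ 2 - X ^ 2 := by nlinarith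
  set ε := l / t₁ with hεdef
  have hε : 0 < ε := by positivity
  have hε' : ε ≤ 1 / 8 := by rw [div_le_iff₀ ht₁]; linarith
  rw [twoPointEnergy, hb t₁ ht₁, hb t₂ ht₂, hX2, hY2] at h
  have hA : g t₁ ^ 2 / t₁ ≤ 1 := le_trans (le_add_of_nonneg_right (by positivity)) h
  have hA' : 1 - ε ≤ g t₁ ^ 2 / t₁ := by
    rw [hεdef, sub_le_iff_le_add, ← add_div, le_div_iff₀ ht₁]; linarith
  have hp2 : (|g t₁| / Real.sqrt t₁) ^ 2 = g t₁ ^ 2 / t₁ := by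
    rw [div_pow, sq_abs, Real.sq_sqrt ht₁.le]
  have hq2 : (|g t₂| / Real.sqrt t₂) ^ 2 = g t₂ ^ 2 / t₂ := by
    rw [div_pow, sq_abs, Real.sq_sqrt ht₂.le]
  have hp : |g t₁| / Real.sqrt t₁ ≤ 1 := by
    rw [← hp2] at hA
    nlinarith [abs_nonneg (g t₁), Real.sqrt_nonneg t₁]
  have hq : 1 - ε ≤ |g t₂| / Real.sqrt t₂ := by
    have h1 : 1 - ε ≤ g t₂ ^ 2 / t₂ := by
      have : l / t₂ ≤ ε := by rw [hεdef]; gcongr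
      have : 1 - l / t₂ ≤ g t₂ ^ 2 / t₂ := by
        rw [sub_le_iff_le_add, ← add_div, le_div_iff₀ ht₂]; linarith
      linarith
    have h0 : 0 ≤ |g t₂| / Real.sqrt t₂ := by positivity
    rw [← hq2] at h1
    by_contra! hc
    nlinarith
  have hsq : (|g t₂| / Real.sqrt t₂ * Y - |g t₁| / Real.sqrt t₁ * X) ^ 2 ≤ ε * (Y ^ 2 - X ^ 2) := by
    have e1 : |g t₂| / Real.sqrt t₂ * Y = |g t₂ * (Y / Real.sqrt t₂)| := by
      rw [abs_mul, abs_of_pos (by positivity : 0 < Y / Real.sqrt t₂)]; ring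
    have e2 : |g t₁| / Real.sqrt t₁ * X = |g t₁ * (X / Real.sqrt t₁)| := by
      rw [abs_mul, abs_of_pos (by positivity : 0 < X / Real.sqrt t₁)]; ring
    rw [e1, e2]
    refine (sq_le_sq.2 (abs_abs_sub_abs_le_abs_sub _ _)).trans ?_
    rw [← div_le_iff₀ hD]
    linarith
  have hfin := le_of_sq_sub_le hX hXY.le hp hq hε hε' hsq
  have h8 : Y ≤ Real.exp (8 * ε) * X :=
    hfin.trans (by gcongr; linarith [Real.add_one_le_exp (8 * ε)])
  have ht2 : t₂ ≤ Real.exp (16 * ε / ν) * t₁ := by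
    have h9 := Real.rpow_le_rpow hY.le h8 (by positivity : 0 ≤ 2 / ν)
    rw [Real.mul_rpow (Real.exp_nonneg _) hX.le, ← Real.rpow_mul ht₂.le, ← Real.rpow_mul ht₁.le,
      ← Real.exp_mul, show ν / 2 * (2 / ν) = 1 by field_simp, Real.rpow_one, Real.rpow_one] at h9
    convert h9 using 3
    ring
  have hexp : Real.exp (16 * ε / ν) - 1 ≤ 16 * ε / ν * Real.exp (2 / ν) := by
    have h1 : 1 - 16 * ε / ν ≤ Real.exp (-(16 * ε / ν)) := by
      linarith [Real.add_one_le_exp (-(16 * ε / ν))]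
    have h2 : Real.exp (16 * ε / ν) ≤ Real.exp (2 / ν) := by
      gcongr; linarith
    have h3 : Real.exp (16 * ε / ν) * Real.exp (-(16 * ε / ν)) = 1 := by
      rw [← Real.exp_add]; simp
    have h4 : 0 ≤ 16 * ε / ν := by positivity
    nlinarith [Real.exp_pos (16 * ε / ν), mul_le_mul_of_nonneg_left h1
      (Real.exp_pos (16 * ε / ν)).le, mul_le_mul_of_nonneg_left h2 h4]
  calc t₂ - t₁ ≤ (Real.exp (16 * ε / ν) - 1) * t₁ := by linarith
    _ ≤ 16 * ε / ν * Real.exp (2 / ν) * t₁ := by gcongr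
    _ = _ := by rw [hεdef]; field_simp

lemma exists_measurableSet_superset_sublevel {ν : ℝ} (hν : 0 < ν) {g : ℝ → ℝ} {S : Set ℝ}
    (h : ∀ t₁ ∈ S, ∀ t₂ ∈ S, 0 < t₁ → t₁ < t₂ → twoPointEnergy ν g t₁ t₂ ≤ 1)
    {l : ℝ} (hl : 0 < l) :
    ∃ I : Set ℝ, MeasurableSet I ∧ (∀ s ∈ S, 0 < s → s - g s ^ 2 ≤ l → s ∈ I) ∧
      volume I ≤ ENNReal.ofReal ((8 + 2 * (16 / ν * Real.exp (2 / ν))) * l) := by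
  set C := 16 / ν * Real.exp (2 / ν)
  have hC : 0 < C := by positivity
  -- One reference point t beyond 8l suffices: every other such point lies within C·l of it.
  by_cases hex : ∃ t ∈ S, 8 * l ≤ t ∧ t - g t ^ 2 ≤ l
  · obtain ⟨t, htS, ht8, htl⟩ := hex
    refine ⟨Icc 0 (8 * l) ∪ Icc (t - C * l) (t + C * l),
      measurableSet_Icc.union measurableSet_Icc, fun s hs hs0 hsl => ?_, ?_⟩
    · rcases le_or_gt s (8 * l) with h8 | h8
      · exact Or.inl ⟨hs0.le, h8⟩
      · right
        have ht0 : 0 < t := by linarith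
        have hCl : 0 < C * l := by positivity
        rcases lt_trichotomy s t with hst | hst | hst
        · have := sub_le_of_twoPointEnergy_le_one hν hs0 hst hl h8.le hsl htl (h s hs t htS hs0 hst)
          constructor <;> linarith
        · constructor <;> linarith
        · have := sub_le_of_twoPointEnergy_le_one hν ht0 hst hl ht8 htl hsl (h t htS s hs ht0 hst)
          constructor <;> linarith
    · refine (measure_union_le _ _).trans ?_
      rw [Real.volume_Icc, Real.volume_Icc, ← ENNReal.ofReal_add (by linarith)
        (by nlinarith [mul_pos hC hl])]
      apply ENNReal.ofReal_le_ofReal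
      linarith
  · push Not at hex
    refine ⟨Icc 0 (8 * l), measurableSet_Icc, fun s hs hs0 hsl => ⟨hs0.le, ?_⟩, ?_⟩
    · by_contra! hc
      exact absurd hsl (not_le.2 (hex s hs hc.le))
    · rw [Real.volume_Icc]
      apply ENNReal.ofReal_le_ofReal
      nlinarith [mul_pos hC hl]

theorem exists_lintegral_exp_le_of_twoPointEnergy_le_one {ν : ℝ} (hν : 0 < ν) :
    ∃ C : ℝ≥0∞, C < ∞ ∧ ∀ (g : ℝ → ℝ) (S : Set ℝ),
      (∀ᵐ s ∂(volume.restrict (Ioi 0) : Measure ℝ), s ∈ S) →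
      (∀ t₁ ∈ S, ∀ t₂ ∈ S, 0 < t₁ → t₁ < t₂ → twoPointEnergy ν g t₁ t₂ ≤ 1) →
      ∫⁻ s in Ioi 0, ENNReal.ofReal (Real.exp (2 * (g s ^ 2 - s))) ≤ C := by
  set D := 8 + 2 * (16 / ν * Real.exp (2 / ν))
  have hD : 0 < D := by positivity
  have hsum : Summable fun k : ℕ => Real.exp (-2 * k) * (D * (k + 1)) := by
    have h1 : Summable fun k : ℕ => ((k : ℝ) ^ 1) * Real.exp (-2) ^ k :=
      summable_pow_mul_geometric_of_norm_lt_one 1 (by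
        rw [Real.norm_of_nonneg (Real.exp_nonneg _)]; simp)
    have h2 : Summable fun k : ℕ => Real.exp (-2) ^ k :=
      summable_geometric_of_lt_one (Real.exp_nonneg _) (by simp)
    refine ((h1.add h2).mul_left D).congr fun k => ?_
    rw [← Real.exp_nat_mul]
    ring_nf
  refine ⟨∑' k : ℕ, ENNReal.ofReal (Real.exp (-2 * k) * (D * (k + 1))), ?_, fun g S hS h => ?_⟩
  · rw [← ENNReal.ofReal_tsum_of_nonneg (fun k => by positivity) hsum]
    exact ENNReal.ofReal_lt_top
  · choose I hIm hI hIv using fun k : ℕ =>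
      exists_measurableSet_superset_sublevel hν h (l := k + 1) (by positivity)
    have hpt : ∀ s ∈ S, 0 < s → ENNReal.ofReal (Real.exp (2 * (g s ^ 2 - s))) ≤
        ∑' k : ℕ, (I k).indicator (fun _ => ENNReal.ofReal (Real.exp (-2 * k))) s := by
      intro s hs hs0
      -- The hypothesis concerns pairs only, so g² ≤ s needs a second point of S to the right of s;
      -- S has full measure.
      have hnn : 0 ≤ s - g s ^ 2 := by
        have hfr : ∃ t ∈ S, s < t := by
          by_contra! hc
          have hsub : Ioi s ⊆ {t | ¬t ∈ S} := fun t ht hts => absurd (hc t hts) (not_le.2 ht)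
          have h0 : (volume.restrict (Ioi 0) : Measure ℝ) (Ioi s) = 0 :=
            measure_mono_null hsub (ae_iff.1 hS)
          rw [Measure.restrict_apply measurableSet_Ioi,
            inter_eq_left.2 (Ioi_subset_Ioi hs0.le)] at h0
          simp at h0
        obtain ⟨t, ht, hst⟩ := hfr
        have h1 := h s hs t ht hs0 hst
        have hDp : 0 < t ^ ν - s ^ ν := sub_pos.2 (Real.rpow_lt_rpow hs0.le hst hν)
        have h2 : g s ^ 2 / s ≤ 1 :=
          le_trans (le_add_of_nonneg_right (by positivity)) h1
        rw [div_le_one hs0] at h2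
        linarith
      -- With k the integer part of s - g², the point s lies in the set of level k + 1 and the
      -- integrand is at most e^{-2k}.
      refine le_trans ?_ (ENNReal.le_tsum ⌊s - g s ^ 2⌋₊)
      rw [indicator_of_mem (hI _ s hs hs0 (Nat.lt_floor_add_one _).le)]
      apply ENNReal.ofReal_le_ofReal
      refine Real.exp_le_exp.2 ?_
      linarith [Nat.floor_le hnn]
    calc ∫⁻ s in Ioi 0, ENNReal.ofReal (Real.exp (2 * (g s ^ 2 - s)))
        ≤ ∫⁻ s in Ioi 0, ∑' k : ℕ,
            (I k).indicator (fun _ => ENNReal.ofReal (Real.exp (-2 * k))) s := by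
          refine lintegral_mono_ae ?_
          filter_upwards [hS, ae_restrict_mem measurableSet_Ioi] with s hs hs0 using hpt s hs hs0
      _ ≤ ∫⁻ s, ∑' k : ℕ, (I k).indicator (fun _ => ENNReal.ofReal (Real.exp (-2 * k))) s :=
          setLIntegral_le_lintegral _ _
      _ = ∑' k : ℕ, ENNReal.ofReal (Real.exp (-2 * k)) * volume (I k) := by
          rw [lintegral_tsum fun k => (measurable_const.indicator (hIm k)).aemeasurable]
          simp_rw [lintegral_indicator_const (hIm _)]
      _ ≤ _ := by
          refine ENNReal.tsum_le_tsum fun k => ?_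
          rw [ENNReal.ofReal_mul (Real.exp_nonneg _)]
          gcongr
          exact hIv k

/-! ### Energies of test functions along rays. -/

/-- The integrand of `‖φ‖_μ²`. -/
noncomputable def energyDensity (μ : ℝ) (φ : Plane → ℝ) (x : Plane) : ℝ :=
  ‖(∇ φ : Plane → Plane) x‖ ^ 2 + μ * (φ x ^ 2 / (‖x‖ ^ 2 * (-Real.log ‖x‖) ^ 2))

lemma testNorm_eq (μ : ℝ) (φ : 𝓓(unitDisc, ℝ)) :
    testNorm μ φ = Real.sqrt (∫ x, energyDensity μ φ x ∂discMeasure) := rfl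

lemma norm_gradient (φ : Plane → ℝ) (x : Plane) :
    ‖(∇ φ : Plane → Plane) x‖ = ‖fderiv ℝ φ x‖ := by
  rw [← toDual_gradient, LinearIsometryEquiv.norm_map]

/-- The weight e^{-2s} equals |x|², so it cancels the factor |x|^{-2} of the Leray potential. -/
lemma energyDensity_logPolar (μ : ℝ) (φ : Plane → ℝ) (p : Metric.sphere (0 : Plane) 1 × ℝ) :
    Real.exp (-2 * p.2) * energyDensity μ φ (logPolar p) =
      Real.exp (-2 * p.2) * ‖fderiv ℝ φ (logPolar p)‖ ^ 2 + μ * (φ (logPolar p) ^ 2 / p.2 ^ 2) := by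
  have h : Real.exp (-2 * p.2) = Real.exp (-p.2) ^ 2 := by
    rw [← Real.exp_nat_mul]; congr 1; push_cast; ring
  rw [energyDensity, norm_gradient, norm_logPolar, Real.log_exp, h, neg_neg]
  have := Real.exp_pos (-p.2)
  field_simp

section TestFunction

variable (φ : 𝓓(unitDisc, ℝ))

lemma differentiable_test : Differentiable ℝ φ :=
  φ.contDiff.differentiable (by simp)

lemma continuous_fderiv_test : Continuous (fderiv ℝ φ) :=
  φ.contDiff.continuous_fderiv (by simp)

lemma measurable_energyDensity (μ : ℝ) : Measurable (energyDensity μ φ) := by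
  have h1 : Measurable fun x => ‖(∇ φ : Plane → Plane) x‖ := by
    simp_rw [norm_gradient]
    exact (continuous_fderiv_test φ).norm.measurable
  have h2 : Measurable φ := φ.continuous.measurable
  unfold energyDensity
  fun_prop

lemma exists_abs_le : ∃ m, ∀ x, |φ x| ≤ m :=
  φ.continuous.bounded_above_of_compact_support φ.hasCompactSupport

lemma exists_norm_fderiv_le : ∃ m, ∀ x, ‖fderiv ℝ φ x‖ ≤ m :=
  (continuous_fderiv_test φ).bounded_above_of_compact_support (φ.hasCompactSupport.fderiv ℝ)

lemma exists_logPolar_eq_zero :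
    ∃ s₀ > 0, ∀ θ : Metric.sphere (0 : Plane) 1, ∀ s ≤ s₀, φ (logPolar (θ, s)) = 0 := by
  obtain ⟨ρ, ⟨hρ0, hρ1⟩, hρ⟩ := exists_pos_lt_subset_ball one_pos
    (isClosed_tsupport φ) (φ.tsupport_subset : tsupport φ ⊆ Metric.ball 0 1)
  refine ⟨-Real.log ρ, neg_pos.2 (Real.log_neg hρ0 hρ1), fun θ s hs => ?_⟩
  by_contra h
  have := hρ (subset_tsupport _ (Function.mem_support.2 h))
  rw [mem_ball_zero_iff, norm_logPolar, ← Real.lt_log_iff_exp_lt hρ0] at this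
  linarith

/-- Compact support removes the singularity at s = 0, and s^{-2} is integrable at infinity. The
bound is uniform in θ, as Fubini requires. -/
lemma exists_density_bound (μ : ℝ) : ∃ B : ℝ → ℝ, Integrable B expMeasure ∧
    ∀ θ s, 0 < s → ‖energyDensity μ φ (logPolar (θ, s))‖ ≤ B s := by
  obtain ⟨m, hm⟩ := exists_abs_le φ
  obtain ⟨m', hm'⟩ := exists_norm_fderiv_le φ
  obtain ⟨s₀, hs₀, hz⟩ := exists_logPolar_eq_zero φ
  refine ⟨fun s => Real.exp (2 * s) * (Real.exp (-2 * s) * m' ^ 2 +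
    (Ioi s₀).indicator (fun s => |μ| * m ^ 2 * s ^ (-2 : ℝ)) s), ?_, fun θ s hs => ?_⟩
  · rw [integrable_expMeasure_iff]
    have h1 : IntegrableOn (fun s : ℝ => Real.exp (-2 * s) * m' ^ 2) (Ioi 0) :=
      (integrableOn_exp_mul_Ioi (by norm_num) 0).mul_const _
    have h2 : IntegrableOn ((Ioi s₀).indicator fun s : ℝ => |μ| * m ^ 2 * s ^ (-2 : ℝ)) (Ioi 0) := by
      refine Integrable.integrableOn ?_
      rw [integrable_indicator_iff measurableSet_Ioi]
      exact (integrableOn_Ioi_rpow_of_lt (by norm_num) hs₀).const_mul _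
    refine (h1.add h2).congr_fun (fun s _ => ?_) measurableSet_Ioi
    simp only [Pi.add_apply]
    rw [← mul_assoc, ← Real.exp_add]
    simp
  · have h0 : energyDensity μ φ (logPolar (θ, s)) = Real.exp (2 * s) *
        (Real.exp (-2 * s) * energyDensity μ φ (logPolar (θ, s))) := by
      rw [← mul_assoc, ← Real.exp_add]; simp
    have h1 := energyDensity_logPolar μ φ (θ, s)
    dsimp only at h1
    rw [h0, h1, norm_mul, Real.norm_of_nonneg (Real.exp_nonneg _)]
    refine mul_le_mul_of_nonneg_left ?_ (Real.exp_nonneg _)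
    refine (norm_add_le _ _).trans (add_le_add ?_ ?_)
    · rw [Real.norm_of_nonneg (by positivity)]
      gcongr
      exact hm' _
    · by_cases hss : s ≤ s₀
      · rw [hz θ s hss]
        simp [hss]
      · rw [indicator_of_mem (by simpa using hss), Real.rpow_neg hs.le, Real.rpow_two, norm_mul,
          Real.norm_eq_abs, Real.norm_of_nonneg (by positivity), mul_assoc, ← div_eq_mul_inv]
        refine mul_le_mul_of_nonneg_left (mul_le_mul_of_nonneg_right ?_ (by positivity))
          (abs_nonneg μ)
        exact sq_le_sq.2 ((hm _).trans (le_abs_self m))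

lemma integrable_energyDensity_ray (μ : ℝ) (θ : Metric.sphere (0 : Plane) 1) :
    Integrable (fun s => energyDensity μ φ (logPolar (θ, s))) expMeasure := by
  obtain ⟨B, hB, hle⟩ := exists_density_bound φ μ
  refine hB.mono' ((measurable_energyDensity φ μ).comp
    (continuous_logPolar.measurable.comp (by fun_prop))).aestronglyMeasurable ?_
  rw [ae_expMeasure_iff]
  filter_upwards [ae_restrict_mem measurableSet_Ioi] with s hs using hle θ s hs

lemma integrable_energyDensity_prod (μ : ℝ) :
    Integrable (fun p => energyDensity μ φ (logPolar p)) (circleMeasure.prod expMeasure) := by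
  obtain ⟨B, hB, hle⟩ := exists_density_bound φ μ
  refine (hB.comp_snd circleMeasure).mono' ((measurable_energyDensity φ μ).comp
    continuous_logPolar.measurable).aestronglyMeasurable ?_
  have h1 : ∀ᵐ s ∂expMeasure, 0 < s :=
    ae_expMeasure_iff.2 (ae_restrict_mem measurableSet_Ioi)
  have h2 : ∀ᵐ p ∂(circleMeasure.prod expMeasure), 0 < p.2 :=
    Measure.quasiMeasurePreserving_snd.ae h1
  filter_upwards [h2] with p hp using hle p.1 p.2 hp

lemma integrable_energyDensity (μ : ℝ) : Integrable (energyDensity μ φ) discMeasure := by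
  rw [← map_logPolar, integrable_map_measure
    (measurable_energyDensity φ μ).aestronglyMeasurable continuous_logPolar.aemeasurable]
  exact integrable_energyDensity_prod φ μ

/-- The energy of `φ` along the ray in direction `θ`. -/
noncomputable def rayEnergy (μ : ℝ) (φ : Plane → ℝ) (θ : Metric.sphere (0 : Plane) 1) : ℝ :=
  ∫ s, energyDensity μ φ (logPolar (θ, s)) ∂expMeasure

lemma measurable_rayEnergy (μ : ℝ) : Measurable (rayEnergy μ φ) := by
  have h : StronglyMeasurable fun p => energyDensity μ φ (logPolar p) :=
    ((measurable_energyDensity φ μ).comp continuous_logPolar.measurable).stronglyMeasurable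
  exact h.integral_prod_right.measurable

lemma integrable_rayEnergy (μ : ℝ) : Integrable (rayEnergy μ φ) circleMeasure :=
  (integrable_energyDensity_prod φ μ).integral_prod_left

lemma integral_energyDensity_eq (μ : ℝ) :
    ∫ x, energyDensity μ φ x ∂discMeasure = ∫ θ, rayEnergy μ φ θ ∂circleMeasure := by
  rw [← map_logPolar, integral_map continuous_logPolar.aemeasurable
    (measurable_energyDensity φ μ).aestronglyMeasurable,
    integral_prod _ (integrable_energyDensity_prod φ μ)]
  rfl

/-- The radial derivative is bounded by the full gradient, so the ray energy dominates the
one-dimensional energy without any symmetry of φ. -/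
lemma twoPointEnergy_le_rayEnergy {μ ν : ℝ} (hν : 0 < ν) (hμν : ν ^ 2 = 1 + 4 * μ)
    (θ : Metric.sphere (0 : Plane) 1) {t₁ t₂ : ℝ} (ht₁ : 0 < t₁) (ht : t₁ < t₂) :
    ν * twoPointEnergy ν (fun s => φ (logPolar (θ, s))) t₁ t₂ ≤ rayEnergy μ φ θ := by
  obtain ⟨m, hm⟩ := exists_abs_le φ
  obtain ⟨s₀, hs₀, hz⟩ := exists_logPolar_eq_zero φ
  rw [rayEnergy, integral_expMeasure]
  have hd : ∀ s, HasDerivAt (fun s => φ (logPolar (θ, s)))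
      (fderiv ℝ φ (logPolar (θ, s)) (-Real.exp (-s) • (θ : Plane))) s := by
    intro s
    have h1 : HasDerivAt (fun s => logPolar (θ, s)) (-Real.exp (-s) • (θ : Plane)) s := by
      have := ((hasDerivAt_id s).neg.exp).smul_const (θ : Plane)
      simpa [logPolar] using this
    exact (differentiable_test φ _).hasFDerivAt.comp_hasDerivAt s h1
  refine twoPointEnergy_le_integral hν hd hs₀ (hz θ) (fun s => hm _)
    ((integrable_expMeasure_iff _).1 (integrable_energyDensity_ray φ μ θ)) (fun s hs => ?_) ht₁ ht
  have h1 := energyDensity_logPolar μ φ (θ, s)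
  dsimp only at h1
  rw [h1, show (ν ^ 2 - 1) / 4 = μ by rw [hμν]; ring]
  gcongr
  rw [← sq_abs, show Real.exp (-2 * s) = Real.exp (-s) ^ 2 by
    rw [← Real.exp_nat_mul]; congr 1; push_cast; ring, ← mul_pow]
  gcongr
  rw [← Real.norm_eq_abs, mul_comm]
  refine (ContinuousLinearMap.le_opNorm _ _).trans ?_
  simp [norm_smul]

lemma twoPointEnergy_nonneg {ν : ℝ} (hν : 0 < ν) (g : ℝ → ℝ) {t₁ t₂ : ℝ} (ht₁ : 0 < t₁)
    (ht : t₁ < t₂) : 0 ≤ twoPointEnergy ν g t₁ t₂ := by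
  have hD : 0 < t₂ ^ ν - t₁ ^ ν := sub_pos.2 (Real.rpow_lt_rpow ht₁.le ht hν)
  unfold twoPointEnergy
  positivity

/-- For negative μ the density changes sign; positivity along each ray comes from the two-point
bound, here at the arbitrary points 1 and 2. -/
lemma rayEnergy_nonneg {μ : ℝ} (hμ : -(1 / 4 : ℝ) < μ) (θ : Metric.sphere (0 : Plane) 1) :
    0 ≤ rayEnergy μ φ θ := by
  have hν : 0 < Real.sqrt (1 + 4 * μ) := Real.sqrt_pos.2 (by linarith)
  exact (mul_nonneg hν.le (twoPointEnergy_nonneg hν _ one_pos one_lt_two)).trans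
    (twoPointEnergy_le_rayEnergy φ hν (Real.sq_sqrt (by linarith)) θ one_pos one_lt_two)

lemma integral_energyDensity_nonneg {μ : ℝ} (hμ : -(1 / 4 : ℝ) < μ) :
    0 ≤ ∫ x, energyDensity μ φ x ∂discMeasure := by
  rw [integral_energyDensity_eq]
  exact integral_nonneg fun θ => rayEnergy_nonneg φ hμ θ

lemma sq_testNorm {μ : ℝ} (hμ : -(1 / 4 : ℝ) < μ) :
    testNorm μ φ ^ 2 = ∫ x, energyDensity μ φ x ∂discMeasure := by
  rw [testNorm_eq, Real.sq_sqrt (integral_energyDensity_nonneg φ hμ)]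

lemma gradient_add_test (ψ : 𝓓(unitDisc, ℝ)) (x : Plane) :
    (∇ (φ + ψ : 𝓓(unitDisc, ℝ)) : Plane → Plane) x = ∇ φ x + ∇ ψ x := by
  simp only [gradient]
  rw [FunLike.coe_add, fderiv_add (differentiable_test φ x) (differentiable_test ψ x), map_add]

lemma gradient_sub_test (ψ : 𝓓(unitDisc, ℝ)) (x : Plane) :
    (∇ (φ - ψ : 𝓓(unitDisc, ℝ)) : Plane → Plane) x = ∇ φ x - ∇ ψ x := by
  simp only [gradient]
  rw [FunLike.coe_sub, fderiv_sub (differentiable_test φ x) (differentiable_test ψ x), map_sub]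

/-- The parallelogram law with one nonnegative term dropped; this replaces the triangle inequality.
-/
lemma sq_testNorm_add_le {μ : ℝ} (hμ : -(1 / 4 : ℝ) < μ) (ψ : 𝓓(unitDisc, ℝ)) :
    testNorm μ (φ + ψ) ^ 2 ≤ 2 * testNorm μ φ ^ 2 + 2 * testNorm μ ψ ^ 2 := by
  have hpt : ∀ x, energyDensity μ (φ + ψ : 𝓓(unitDisc, ℝ)) x +
      energyDensity μ (φ - ψ : 𝓓(unitDisc, ℝ)) x =
      2 * energyDensity μ φ x + 2 * energyDensity μ ψ x := by
    intro x
    have h := parallelogram_law_with_norm ℝ (∇ φ x) (∇ ψ x)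
    simp only [energyDensity, gradient_add_test, gradient_sub_test, add_apply,
      sub_apply]
    linear_combination h
  have h0 := integral_energyDensity_nonneg (φ - ψ) hμ
  rw [sq_testNorm _ hμ, sq_testNorm _ hμ, sq_testNorm _ hμ]
  have : (∫ x, energyDensity μ (φ + ψ : 𝓓(unitDisc, ℝ)) x ∂discMeasure) +
      (∫ x, energyDensity μ (φ - ψ : 𝓓(unitDisc, ℝ)) x ∂discMeasure) =
      2 * (∫ x, energyDensity μ φ x ∂discMeasure) + 2 * ∫ x, energyDensity μ ψ x ∂discMeasure := by
    rw [← integral_add (integrable_energyDensity _ μ) (integrable_energyDensity _ μ),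
      ← integral_const_mul, ← integral_const_mul,
      ← integral_add ((integrable_energyDensity _ μ).const_mul _)
        ((integrable_energyDensity _ μ).const_mul _)]
    exact integral_congr_ae (.of_forall hpt)
  linarith

end TestFunction

/-! ### Passage to the completion and the critical bound. -/

lemma Represents.comp_strictMono {μ : ℝ} {φ : ℕ → 𝓓(unitDisc, ℝ)} {u : Lp ℝ 2 discMeasure}
    (h : Represents μ φ u) {k : ℕ → ℕ} (hk : StrictMono k) : Represents μ (φ ∘ k) u := by
  refine ⟨fun ε hε => ?_, h.2.comp hk.tendsto_atTop⟩
  obtain ⟨N, hN⟩ := h.1 ε hε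
  exact ⟨N, fun m n hm hn => hN _ _ (hm.trans (hk.id_le m)) (hn.trans (hk.id_le n))⟩

/-- Makes the set defining `lerayNorm` nonempty, so its infimum is not the default value. Norms
along a Cauchy sequence are bounded, and a subsequence of them converges. -/
lemma exists_represents_tendsto_testNorm {μ : ℝ} (hμ : -(1 / 4 : ℝ) < μ)
    {u : Lp ℝ 2 discMeasure} (hu : u ∈ leraySpace μ) :
    ∃ c φ, Represents μ φ u ∧ Tendsto (fun n => testNorm μ (φ n)) atTop (𝓝 c) := by
  obtain ⟨φ, hφ⟩ := hu
  obtain ⟨N, hN⟩ := hφ.1 1 one_pos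
  set R := Real.sqrt (2 + 2 * testNorm μ (φ N) ^ 2)
  have hb : ∀ n, testNorm μ (φ (n + N)) ∈ Icc 0 R := by
    intro n
    refine ⟨Real.sqrt_nonneg _, Real.le_sqrt_of_sq_le ?_⟩
    have h1 := hN (n + N) N (by omega) le_rfl
    have h2 := sq_testNorm_add_le (φ (n + N) - φ N) hμ (φ N)
    rw [sub_add_cancel] at h2
    have h3 : testNorm μ (φ (n + N) - φ N) ^ 2 ≤ 1 :=
      pow_le_one₀ (Real.sqrt_nonneg _) h1.le
    linarith
  obtain ⟨c, -, k, hk, hc⟩ := isCompact_Icc.tendsto_subseq hb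
  exact ⟨c, φ ∘ fun n => k n + N, hφ.comp_strictMono fun a b hab => by
    have := hk hab
    show k a + N < k b + N
    omega, hc⟩

/-- By Fatou the liminf of the ray energies has average at most c²/(2π). Some direction outside any
given null set lies below that average, and there the two-point bounds pass to the pointwise limit
f. -/
lemma exists_ray_twoPointEnergy_le {μ ν : ℝ} (hμ : -(1 / 4 : ℝ) < μ) (hν : 0 < ν)
    (hμν : ν ^ 2 = 1 + 4 * μ) {u : Lp ℝ 2 discMeasure} {f : ℝ → ℝ}
    (hf : ∀ᵐ x ∂discMeasure, u x = f ‖x‖) {φ : ℕ → 𝓓(unitDisc, ℝ)} {c : ℝ}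
    (hφ : Represents μ φ u) (hc : Tendsto (fun n => testNorm μ (φ n)) atTop (𝓝 c)) :
    ∃ S : Set ℝ, (∀ᵐ s ∂(volume.restrict (Ioi 0) : Measure ℝ), s ∈ S) ∧
      ∀ t₁ ∈ S, ∀ t₂ ∈ S, 0 < t₁ → t₁ < t₂ →
        2 * Real.pi * ν * twoPointEnergy ν (fun s => f (Real.exp (-s))) t₁ t₂ ≤ c ^ 2 := by
  obtain ⟨k, hk, hkae⟩ := (tendstoInMeasure_of_tendsto_eLpNorm (g := u) (by norm_num)
    (fun n => (φ n).continuous.aestronglyMeasurable) (Lp.aestronglyMeasurable u)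
    hφ.2).exists_seq_tendsto_ae
  have hae : ∀ᵐ x ∂discMeasure, Tendsto (fun n => φ (k n) x) atTop (𝓝 (f ‖x‖)) := by
    filter_upwards [hkae, hf] with x h1 h2
    rwa [← h2]
  rw [← map_logPolar] at hae
  have hae' := Measure.ae_ae_of_ae_prod (ae_of_ae_map continuous_logPolar.aemeasurable hae)
  have hmeas : ∀ n, Measurable fun θ => ENNReal.ofReal (rayEnergy μ (φ (k n)) θ) :=
    fun n => (measurable_rayEnergy (φ (k n)) μ).ennreal_ofReal
  have hint : ∀ n, ∫⁻ θ, ENNReal.ofReal (rayEnergy μ (φ (k n)) θ) ∂circleMeasure =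
      ENNReal.ofReal (testNorm μ (φ (k n)) ^ 2) := by
    intro n
    rw [sq_testNorm _ hμ, integral_energyDensity_eq, ofReal_integral_eq_lintegral_ofReal
      (integrable_rayEnergy (φ (k n)) μ) (.of_forall fun θ => rayEnergy_nonneg (φ (k n)) hμ θ)]
  have hfatou : ∫⁻ θ, liminf (fun n => ENNReal.ofReal (rayEnergy μ (φ (k n)) θ)) atTop
      ∂circleMeasure ≤ ENNReal.ofReal (c ^ 2) := by
    refine (lintegral_liminf_le hmeas).trans_eq ?_
    simp_rw [hint]
    exact (ENNReal.tendsto_ofReal ((hc.comp hk.tendsto_atTop).pow 2)).liminf_eq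
  have hne : circleMeasure ≠ 0 := Measure.toSphere_ne_zero _
  obtain ⟨θ, hθN, hθ⟩ := exists_notMem_null_le_laverage hne (Measurable.liminf hmeas).aemeasurable
    (ae_iff.1 hae')
  have hθS : ∀ᵐ s ∂expMeasure, Tendsto (fun n => φ (k n) (logPolar (θ, s))) atTop
      (𝓝 (f ‖logPolar (θ, s)‖)) := by simpa using hθN
  rw [ae_expMeasure_iff] at hθS
  refine ⟨{s | Tendsto (fun n => φ (k n) (logPolar (θ, s))) atTop (𝓝 (f ‖logPolar (θ, s)‖))},
    hθS, fun t₁ h₁ t₂ h₂ ht₁ ht => ?_⟩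
  have h₁' : Tendsto (fun n => φ (k n) (logPolar (θ, t₁))) atTop (𝓝 (f (Real.exp (-t₁)))) := by
    simpa only [norm_logPolar] using mem_ofPred_eq.mp h₁
  have h₂' : Tendsto (fun n => φ (k n) (logPolar (θ, t₂))) atTop (𝓝 (f (Real.exp (-t₂)))) := by
    simpa only [norm_logPolar] using mem_ofPred_eq.mp h₂
  have hlim : Tendsto (fun n => ν * twoPointEnergy ν (fun s => φ (k n) (logPolar (θ, s))) t₁ t₂)
      atTop (𝓝 (ν * twoPointEnergy ν (fun s => f (Real.exp (-s))) t₁ t₂)) := by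
    refine Tendsto.const_mul _ (Tendsto.add ((h₁'.pow 2).div_const _) (Tendsto.div_const ?_ _))
    exact ((h₂'.mul_const _).sub (h₁'.mul_const _)).pow 2
  have hle : ENNReal.ofReal (ν * twoPointEnergy ν (fun s => f (Real.exp (-s))) t₁ t₂) ≤
      ENNReal.ofReal (c ^ 2 / (2 * Real.pi)) := by
    rw [← (ENNReal.tendsto_ofReal hlim).liminf_eq]
    calc _ ≤ liminf (fun n => ENNReal.ofReal (rayEnergy μ (φ (k n)) θ)) atTop := by
          refine liminf_le_liminf (.of_forall fun n => ENNReal.ofReal_le_ofReal ?_)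
          exact twoPointEnergy_le_rayEnergy (φ (k n)) hν hμν θ ht₁ ht
      _ ≤ _ := hθ
      _ ≤ _ := by
          rw [laverage_eq, circleMeasure_univ, ENNReal.ofReal_div_of_pos Real.two_pi_pos]
          gcongr
  rw [ENNReal.ofReal_le_ofReal_iff (by positivity), le_div_iff₀ Real.two_pi_pos] at hle
  linarith

/-- Limits c near the infimum are used, and the corresponding full-measure sets intersected;
uniqueness of the limit norm is thus not needed. -/
lemma exists_twoPointEnergy_le_of_lerayNorm_le_one {μ ν : ℝ} (hμ : -(1 / 4 : ℝ) < μ) (hν : 0 < ν)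
    (hμν : ν ^ 2 = 1 + 4 * μ) {u : Lp ℝ 2 discMeasure} {f : ℝ → ℝ}
    (hf : ∀ᵐ x ∂discMeasure, u x = f ‖x‖) (hu : u ∈ leraySpace μ) (hu1 : lerayNorm μ u ≤ 1) :
    ∃ S : Set ℝ, (∀ᵐ s ∂(volume.restrict (Ioi 0) : Measure ℝ), s ∈ S) ∧
      ∀ t₁ ∈ S, ∀ t₂ ∈ S, 0 < t₁ → t₁ < t₂ →
        2 * Real.pi * ν * twoPointEnergy ν (fun s => f (Real.exp (-s))) t₁ t₂ ≤ 1 := by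
  have hstep : ∀ n : ℕ, ∃ c : ℝ, 0 ≤ c ∧ c < 1 + 1 / (n + 1 : ℝ) ∧
      ∃ φ, Represents μ φ u ∧ Tendsto (fun n => testNorm μ (φ n)) atTop (𝓝 c) := by
    intro n
    have hlt : lerayNorm μ u < 1 + 1 / (n + 1 : ℝ) := by
      have : (0 : ℝ) < 1 / (n + 1 : ℝ) := by positivity
      linarith
    obtain ⟨c, ⟨φ, hφ, hc⟩, hcn⟩ := exists_lt_of_csInf_lt
      (exists_represents_tendsto_testNorm hμ hu) hlt
    exact ⟨c, ge_of_tendsto' hc fun _ => Real.sqrt_nonneg _, hcn, φ, hφ, hc⟩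
  choose c hc0 hc1 φ hφ hc using hstep
  choose S hS hSle using fun n => exists_ray_twoPointEnergy_le hμ hν hμν hf (hφ n) (hc n)
  refine ⟨⋂ n, S n, ?_, fun t₁ h₁ t₂ h₂ ht₁ ht => ?_⟩
  · filter_upwards [ae_all_iff.2 hS] with s hs using mem_iInter.2 hs
  · have hlim : Tendsto (fun n : ℕ => (1 + 1 / (n + 1 : ℝ)) ^ 2) atTop (𝓝 ((1 + 0) ^ 2)) :=
      (tendsto_one_div_add_atTop_nhds_zero_nat.const_add 1).pow 2
    rw [add_zero, one_pow] at hlim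
    refine ge_of_tendsto' hlim fun n => ?_
    refine (hSle n t₁ (mem_iInter.1 h₁ n) t₂ (mem_iInter.1 h₂ n) ht₁ ht).trans ?_
    exact pow_le_pow_left₀ (hc0 n) (hc1 n).le 2

theorem iSup_expIntegral_critical_lt_top {μ : ℝ} (hμ : -(1 / 4 : ℝ) < μ) :
    (⨆ u ∈ {u | u ∈ radialLeraySpace μ ∧ lerayNorm μ u ≤ 1},
      expIntegral (4 * Real.pi * Real.sqrt (1 + 4 * μ)) u) < ∞ := by
  set ν := Real.sqrt (1 + 4 * μ)
  have hν : 0 < ν := Real.sqrt_pos.2 (by linarith)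
  have hμν : ν ^ 2 = 1 + 4 * μ := Real.sq_sqrt (by linarith)
  obtain ⟨C, hC, hmain⟩ := exists_lintegral_exp_le_of_twoPointEnergy_le_one hν
  refine lt_of_le_of_lt (iSup₂_le fun u hu => ?_)
    (ENNReal.mul_lt_top hC (measure_lt_top circleMeasure univ))
  obtain ⟨⟨hu, f, hfm, hf⟩, hu1⟩ := hu
  obtain ⟨S, hS, hSle⟩ := exists_twoPointEnergy_le_of_lerayNorm_le_one hμ hν hμν hf hu hu1
  -- Scaling by √q makes the two-point energy at most 1 and turns 4πνf² into 2g².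
  set q := 2 * Real.pi * ν
  have hq : 0 < q := by positivity
  have hscale : ∀ t₁ t₂, twoPointEnergy ν (fun s => Real.sqrt q * f (Real.exp (-s))) t₁ t₂ =
      q * twoPointEnergy ν (fun s => f (Real.exp (-s))) t₁ t₂ := by
    intro t₁ t₂
    have := Real.sq_sqrt hq.le
    simp only [twoPointEnergy]
    rw [mul_assoc, mul_assoc, ← mul_sub, mul_pow, mul_pow, this]
    ring
  have hb := hmain (fun s => Real.sqrt q * f (Real.exp (-s))) S hS
    fun t₁ h₁ t₂ h₂ ht₁ ht => (hscale t₁ t₂).trans_le (hSle t₁ h₁ t₂ h₂ ht₁ ht)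
  have hF : Measurable fun x : Plane => ENNReal.ofReal (Real.exp (4 * Real.pi * ν * f ‖x‖ ^ 2)) := by
    fun_prop
  calc expIntegral (4 * Real.pi * ν) u
      = ∫⁻ x, ENNReal.ofReal (Real.exp (4 * Real.pi * ν * f ‖x‖ ^ 2)) ∂discMeasure := by
        refine lintegral_congr_ae ?_
        filter_upwards [hf] with x hx
        rw [hx]
    _ = ∫⁻ _ : Metric.sphere (0 : Plane) 1, (∫⁻ s in Ioi 0, ENNReal.ofReal
          (Real.exp (2 * ((Real.sqrt q * f (Real.exp (-s))) ^ 2 - s)))) ∂circleMeasure := by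
        rw [lintegral_disc _ hF]
        refine lintegral_congr fun θ => ?_
        rw [lintegral_expMeasure _ (by simp only [norm_logPolar]; fun_prop)]
        refine lintegral_congr fun s => ?_
        rw [← ENNReal.ofReal_mul (Real.exp_nonneg _), ← Real.exp_add, norm_logPolar, mul_pow,
          Real.sq_sqrt hq.le]
        congr 2
        ring
    _ ≤ C * circleMeasure univ := by
        rw [lintegral_const]
        gcongr

/-! ### Almost extremal profiles for the supercritical case. -/

/-- Smooth almost-minimizers of `∫₀^∞ h'²` among functions on `(0, ∞)` with `h 1 = 1`. -/
lemma exists_smooth_profile {η : ℝ} (hη : 0 < η) (hη1 : η < 1) :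
    ∃ (h : ℝ → ℝ) (p q J : ℝ), ContDiff ℝ (⊤ : ℕ∞) h ∧ 0 < p ∧ p < q ∧ (∀ t ≤ p, h t = 0) ∧
      (∀ t, q ≤ t → h t = 0) ∧ 0 < J ∧ ∫ t in Ioi 0, deriv h t ^ 2 ≤ J ∧
      (1 - η) * J < h 1 ^ 2 := by
  -- The descent takes length at least 2R = 4/η, so its slope is at most η/4.
  set R := 2 / η
  have hR : 0 < R := by positivity
  let ψ₁ : ContDiffBump (1 / 2 : ℝ) := ⟨1 / 2 - η / 8, 1 / 2 - η / 16, by linarith, by linarith⟩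
  let ψ₂ : ContDiffBump (2 + R : ℝ) := ⟨R, R + 1, hR, by linarith⟩
  have hz₁ : ∀ t, t ≤ η / 16 ∨ 1 ≤ t → ψ₁ t = 0 := by
    intro t ht
    refine ψ₁.zero_of_le_dist ?_
    change 1 / 2 - η / 16 ≤ |t - 1 / 2|
    rcases ht with ht | ht
    · rw [abs_of_neg (by linarith)]; linarith
    · rw [abs_of_pos (by linarith)]; linarith
  have ho₁ : ∀ t ∈ Icc (η / 8) (1 - η / 8), ψ₁ t = 1 := by
    intro t ht
    refine ψ₁.one_of_mem_closedBall ?_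
    change |t - 1 / 2| ≤ 1 / 2 - η / 8
    rw [abs_le]
    constructor <;> linarith [ht.1, ht.2]
  have hz₂ : ∀ t, t ≤ 1 ∨ 2 * R + 3 ≤ t → ψ₂ t = 0 := by
    intro t ht
    refine ψ₂.zero_of_le_dist ?_
    change R + 1 ≤ |t - (2 + R)|
    rcases ht with ht | ht
    · rw [abs_of_neg (by linarith)]; linarith
    · rw [abs_of_pos (by linarith)]; linarith
  have ho₂ : ∀ t ∈ Icc 2 (2 * R + 2), ψ₂ t = 1 := by
    intro t ht
    refine ψ₂.one_of_mem_closedBall ?_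
    change |t - (2 + R)| ≤ R
    rw [abs_le]
    constructor <;> linarith [ht.1, ht.2]
  have hc₁ : Continuous ψ₁ := ψ₁.continuous
  have hc₂ : Continuous ψ₂ := ψ₂.continuous
  set q := 2 * R + 3
  set I₁ := ∫ t in (0 : ℝ)..1, ψ₁ t
  set I₂ := ∫ t in (1 : ℝ)..q, ψ₂ t
  have hI₁ : 1 - η / 4 ≤ I₁ := by
    have h1 : ∫ t in (η / 8)..(1 - η / 8), ψ₁ t ≤ I₁ :=
      intervalIntegral.integral_mono_interval (by linarith) (by linarith) (by linarith)
        (.of_forall fun t => ψ₁.nonneg) (hc₁.intervalIntegrable _ _)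
    have h2 : ∫ t in (η / 8)..(1 - η / 8), ψ₁ t = ∫ t in (η / 8)..(1 - η / 8), (1 : ℝ) :=
      intervalIntegral.integral_congr fun t ht => by
        rw [uIcc_of_le (by linarith)] at ht
        exact ho₁ t ht
    rw [h2, intervalIntegral.integral_const] at h1
    simp only [smul_eq_mul, mul_one] at h1
    linarith
  have hI₁' : I₁ ≤ 1 := by
    have h1 : I₁ ≤ ∫ t in (0 : ℝ)..1, (1 : ℝ) :=
      intervalIntegral.integral_mono_on zero_le_one (hc₁.intervalIntegrable _ _)
        (by simp) fun t _ => ψ₁.le_one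
    simpa using h1
  have hI₂ : 2 * R ≤ I₂ := by
    have h1 : ∫ t in (2 : ℝ)..(2 * R + 2), ψ₂ t ≤ I₂ :=
      intervalIntegral.integral_mono_interval (by linarith) (by linarith) (by linarith)
        (.of_forall fun t => ψ₂.nonneg) (hc₂.intervalIntegrable _ _)
    have h2 : ∫ t in (2 : ℝ)..(2 * R + 2), ψ₂ t = ∫ t in (2 : ℝ)..(2 * R + 2), (1 : ℝ) :=
      intervalIntegral.integral_congr fun t ht => by
        rw [uIcc_of_le (by linarith)] at ht
        exact ho₂ t ht
    rw [h2, intervalIntegral.integral_const] at h1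
    simp only [smul_eq_mul, mul_one] at h1
    linarith
  have hI₁0 : 0 < I₁ := by linarith
  have hI₂0 : 0 < I₂ := by linarith
  -- This ratio gives k total integral zero, so its primitive, the profile h, has compact support.
  set κ := I₁ / I₂
  set k : ℝ → ℝ := fun t => ψ₁ t - κ * ψ₂ t
  have hk : Continuous k := by fun_prop
  have hkz : ∀ t, t ≤ η / 16 ∨ q ≤ t → k t = 0 := by
    rintro t (ht | ht)
    · simp only [k]; rw [hz₁ t (Or.inl ht), hz₂ t (Or.inl (by linarith))]; simp
    · simp only [k]; rw [hz₁ t (Or.inr (by linarith)), hz₂ t (Or.inr ht)]; simp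
  have hkd : ∀ t, HasDerivAt (fun x => ∫ t in (0 : ℝ)..x, k t) (k t) t := fun t =>
    intervalIntegral.integral_hasDerivAt_right (hk.intervalIntegrable _ _)
      (hk.stronglyMeasurableAtFilter _ _) hk.continuousAt
  have hderiv : deriv (fun x => ∫ t in (0 : ℝ)..x, k t) = k := funext fun t => (hkd t).deriv
  have h01 : ∫ t in (0 : ℝ)..1, k t = I₁ := by
    refine intervalIntegral.integral_congr fun t ht => ?_
    rw [uIcc_of_le zero_le_one] at ht
    simp only [k]
    rw [hz₂ t (Or.inl ht.2)]; simp
  have h1q : ∫ t in (1 : ℝ)..q, k t = -I₁ := by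
    have : ∫ t in (1 : ℝ)..q, k t = ∫ t in (1 : ℝ)..q, -κ * ψ₂ t := by
      refine intervalIntegral.integral_congr fun t ht => ?_
      rw [uIcc_of_le (by linarith)] at ht
      simp only [k]
      rw [hz₁ t (Or.inr ht.1)]; simp
    rw [this, intervalIntegral.integral_const_mul]
    change -(I₁ / I₂) * I₂ = -I₁
    field_simp
  refine ⟨fun x => ∫ t in (0 : ℝ)..x, k t, η / 16, q, I₁ + κ ^ 2 * I₂, ?_, by positivity,
    by linarith, fun t ht => ?_, fun t ht => ?_, by positivity, ?_, ?_⟩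
  · rw [contDiff_infty_iff_deriv]
    refine ⟨fun t => (hkd t).differentiableAt, ?_⟩
    rw [hderiv]
    exact ψ₁.contDiff.sub (contDiff_const.mul ψ₂.contDiff)
  · dsimp only
    rw [intervalIntegral.integral_congr (g := fun _ => (0 : ℝ)) fun s hs => ?_]
    · simp
    · refine hkz s (Or.inl (hs.2.trans (max_le ?_ ht)))
      positivity
  · dsimp only
    rw [← intervalIntegral.integral_add_adjacent_intervals (b := q)
      (hk.intervalIntegrable _ _) (hk.intervalIntegrable _ _),
      ← intervalIntegral.integral_add_adjacent_intervals (b := 1)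
      (hk.intervalIntegrable _ _) (hk.intervalIntegrable _ _), h01, h1q,
      intervalIntegral.integral_congr (g := fun _ => (0 : ℝ)) fun s hs => ?_]
    · simp
    · rw [uIcc_of_le ht] at hs
      exact hkz s (Or.inr hs.1)
  · rw [hderiv]
    have h1 : ∫ t in Ioi (0 : ℝ), k t ^ 2 = ∫ t in (0 : ℝ)..q, k t ^ 2 := by
      rw [intervalIntegral.integral_of_le (by linarith)]
      refine setIntegral_eq_of_subset_of_forall_sdiff_eq_zero measurableSet_Ioi
        (fun t ht => ht.1) fun t ht => ?_
      have : q ≤ t := by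
        by_contra! hc
        exact ht.2 ⟨ht.1, hc.le⟩
      rw [hkz t (Or.inr this)]; simp
    have hii : ∀ a b : ℝ, IntervalIntegrable (fun t => k t ^ 2) volume a b := fun a b =>
      (hk.pow 2).intervalIntegrable _ _
    rw [h1, ← intervalIntegral.integral_add_adjacent_intervals (hii 0 1) (hii 1 q),
      ← intervalIntegral.integral_const_mul]
    refine add_le_add
      (intervalIntegral.integral_mono_on zero_le_one (hii _ _) (hc₁.intervalIntegrable _ _)
        fun t ht => ?_)
      (intervalIntegral.integral_mono_on (by linarith) (hii _ _)
        ((hc₂.const_mul _).intervalIntegrable _ _) fun t ht => ?_)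
    · simp only [k]
      rw [hz₂ t (Or.inl ht.2), mul_zero, sub_zero]
      nlinarith [ψ₁.nonneg' t, ψ₁.le_one (x := t)]
    · simp only [k]
      rw [hz₁ t (Or.inr ht.1), zero_sub, neg_sq, mul_pow]
      gcongr
      nlinarith [ψ₂.nonneg' t, ψ₂.le_one (x := t)]
  · dsimp only
    rw [h01]
    have hκ : κ ≤ η / 4 := by
      rw [div_le_iff₀ hI₂0]
      have : η * R = 2 := by simp only [R]; field_simp
      nlinarith
    -- The energy bound is I₁(1 + κ) and h(1) = I₁, so (1 - η)(1 + κ) < I₁ remains; it follows from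
    -- I₁ ≥ 1 - η/4 and κ ≤ η/4.
    have e : I₁ + κ ^ 2 * I₂ = I₁ * (1 + κ) := by
      simp only [κ]
      field_simp
    rw [e]
    have : (1 - η) * (1 + κ) < I₁ := by nlinarith
    nlinarith

/-! ### The ground state substitution and its energy identity. -/

/-- The function `s ↦ s^{(1-ν)/2} h(s^ν)` on `(0, ∞)`, extended by zero. -/
noncomputable def logProfile (ν : ℝ) (h : ℝ → ℝ) (s : ℝ) : ℝ :=
  if 0 < s then s ^ ((1 - ν) / 2) * h (s ^ ν) else 0

lemma logProfile_of_pos {ν : ℝ} {h : ℝ → ℝ} {s : ℝ} (hs : 0 < s) :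
    logProfile ν h s = s ^ ((1 - ν) / 2) * h (s ^ ν) := if_pos hs

section LogProfile

variable {ν : ℝ} {h : ℝ → ℝ} {p q : ℝ}

lemma logProfile_eq_zero_of_le (hν : 0 < ν) (hp : 0 < p) (hz : ∀ t ≤ p, h t = 0) {s : ℝ}
    (hs : s ≤ p ^ ν⁻¹) : logProfile ν h s = 0 := by
  unfold logProfile
  split_ifs with h0
  · rw [hz _ ?_, mul_zero]
    have := Real.rpow_le_rpow h0.le hs hν.le
    rwa [← Real.rpow_mul hp.le, inv_mul_cancel₀ hν.ne', Real.rpow_one] at this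
  · rfl

lemma logProfile_eq_zero_of_ge (hν : 0 < ν) (hq : 0 < q) (hz : ∀ t, q ≤ t → h t = 0) {s : ℝ}
    (hs : q ^ ν⁻¹ ≤ s) : logProfile ν h s = 0 := by
  unfold logProfile
  split_ifs with h0
  · rw [hz _ ?_, mul_zero]
    have := Real.rpow_le_rpow (by positivity) hs hν.le
    rwa [← Real.rpow_mul hq.le, inv_mul_cancel₀ hν.ne', Real.rpow_one] at this
  · rfl

lemma contDiff_logProfile (hν : 0 < ν) (hp : 0 < p) (hz : ∀ t ≤ p, h t = 0)
    (hh : ContDiff ℝ (⊤ : ℕ∞) h) : ContDiff ℝ (⊤ : ℕ∞) (logProfile ν h) := by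
  rw [contDiff_iff_contDiffAt]
  intro s
  rcases le_or_gt s 0 with hs | hs
  · have : logProfile ν h =ᶠ[𝓝 s] fun _ => 0 := by
      filter_upwards [Iio_mem_nhds (hs.trans_lt (Real.rpow_pos_of_pos hp ν⁻¹))] with x hx
      exact logProfile_eq_zero_of_le hν hp hz (le_of_lt hx)
    exact contDiffAt_const.congr_of_eventuallyEq this
  · have : logProfile ν h =ᶠ[𝓝 s] fun x => x ^ ((1 - ν) / 2) * h (x ^ ν) := by
      filter_upwards [Ioi_mem_nhds hs] with x hx using logProfile_of_pos hx
    refine ContDiffAt.congr_of_eventuallyEq ?_ this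
    exact (Real.contDiffAt_rpow_const_of_ne hs.ne').mul
      (hh.contDiffAt.comp s (Real.contDiffAt_rpow_const_of_ne hs.ne'))

lemma hasDerivAt_logProfile (hh : Differentiable ℝ h) {s : ℝ} (hs : 0 < s) :
    HasDerivAt (logProfile ν h) ((1 - ν) / 2 * logProfile ν h s / s +
      s ^ ((1 - ν) / 2) * (deriv h (s ^ ν) * (ν * s ^ (ν - 1)))) s := by
  have : logProfile ν h =ᶠ[𝓝 s] fun x => x ^ ((1 - ν) / 2) * h (x ^ ν) := by
    filter_upwards [Ioi_mem_nhds hs] with x hx using logProfile_of_pos hx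
  refine HasDerivAt.congr_of_eventuallyEq ?_ this
  have h1 := Real.hasDerivAt_rpow_const (x := s) (p := (1 - ν) / 2) (Or.inl hs.ne')
  have h2 := (hh (s ^ ν)).hasDerivAt.comp s
    (Real.hasDerivAt_rpow_const (x := s) (p := ν) (Or.inl hs.ne'))
  refine (h1.mul h2).congr_deriv ?_
  rw [logProfile_of_pos hs, Real.rpow_sub_one hs.ne']
  simp only [Function.comp]
  ring

end LogProfile

lemma integrableOn_Ioi_of_eq_zero {F : ℝ → ℝ} {p q : ℝ} (hp : 0 < p)
    (hc : ContinuousOn F (Ioi 0)) (h₁ : ∀ s, 0 < s → s < p → F s = 0)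
    (h₂ : ∀ s, q < s → F s = 0) : IntegrableOn F (Ioi 0) := by
  have h : IntegrableOn F (Icc p q) :=
    (hc.mono fun s hs => hp.trans_le hs.1).integrableOn_Icc
  refine h.of_forall_sdiff_eq_zero measurableSet_Ioi fun s hs => ?_
  by_cases hsp : s < p
  · exact h₁ s hs.1 hsp
  · refine h₂ s ?_
    by_contra! hc
    exact hs.2 ⟨not_lt.1 hsp, hc⟩

section Energy

variable {W : ℝ → ℝ} {p q : ℝ}

lemma deriv_eq_zero_of_lt (h₁ : ∀ s ≤ p, W s = 0) {s : ℝ} (hs : s < p) : deriv W s = 0 := by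
  have : W =ᶠ[𝓝 s] fun _ => 0 := by
    filter_upwards [Iio_mem_nhds hs] with x hx using h₁ x (le_of_lt hx)
  rw [this.deriv_eq, deriv_const]

lemma deriv_eq_zero_of_gt (h₂ : ∀ s, q ≤ s → W s = 0) {s : ℝ} (hs : q < s) : deriv W s = 0 := by
  have : W =ᶠ[𝓝 s] fun _ => 0 := by
    filter_upwards [Ioi_mem_nhds hs] with x hx using h₂ x (le_of_lt hx)
  rw [this.deriv_eq, deriv_const]

lemma integrableOn_energy (μ : ℝ) (hW : ContDiff ℝ (⊤ : ℕ∞) W) (hp : 0 < p)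
    (h₁ : ∀ s ≤ p, W s = 0) (h₂ : ∀ s, q ≤ s → W s = 0) :
    IntegrableOn (fun s => deriv W s ^ 2 + μ * (W s ^ 2 / s ^ 2)) (Ioi 0) := by
  have hW' : Continuous (deriv W) := hW.continuous_deriv (by simp)
  refine integrableOn_Ioi_of_eq_zero hp ?_ (fun s _ hs => ?_) (q := q) fun s hs => ?_
  · have : ContinuousOn (fun s => W s ^ 2 / s ^ 2) (Ioi 0) :=
      (hW.continuous.pow 2).continuousOn.div (by fun_prop) fun s (hs : 0 < s) => by positivity
    exact (hW'.pow 2).continuousOn.add (this.const_smul μ)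
  · simp [deriv_eq_zero_of_lt h₁ hs, h₁ s hs.le]
  · simp [deriv_eq_zero_of_gt h₂ hs, h₂ s hs.le]

lemma integral_deriv_sq_div_eq_zero (a : ℝ) (hW : ContDiff ℝ (⊤ : ℕ∞) W) (hp : 0 < p)
    (h₁ : ∀ s ≤ p, W s = 0) (h₂ : ∀ s, q ≤ s → W s = 0) :
    IntegrableOn (fun s => a * ((2 * W s * deriv W s * s - W s ^ 2) / s ^ 2)) (Ioi 0) ∧
    ∫ s in Ioi 0, a * ((2 * W s * deriv W s * s - W s ^ 2) / s ^ 2) = 0 := by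
  have hW' : Continuous (deriv W) := hW.continuous_deriv (by simp)
  have hWc := hW.continuous
  have hint : IntegrableOn (fun s => a * ((2 * W s * deriv W s * s - W s ^ 2) / s ^ 2))
      (Ioi 0) := by
    refine integrableOn_Ioi_of_eq_zero hp ?_ (fun s _ hs => ?_) (q := q) fun s hs => ?_
    · refine ContinuousOn.const_smul (c := a) (ContinuousOn.div (by fun_prop) (by fun_prop)
        fun s (hs : 0 < s) => by positivity)
    · simp [h₁ s hs.le]
    · simp [h₂ s hs.le]
  refine ⟨hint, ?_⟩
  have hd : ∀ s ∈ Ioi (0 : ℝ), HasDerivAt (fun s => a * (W s ^ 2 / s))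
      (a * ((2 * W s * deriv W s * s - W s ^ 2) / s ^ 2)) s := by
    intro s (hs : 0 < s)
    have hWd := (hW.differentiable (by simp) s).hasDerivAt
    have h1 := ((hWd.pow 2).div (hasDerivAt_id s) hs.ne').const_mul a
    refine h1.congr_deriv ?_
    simp
  have h0 : (fun s => a * (W s ^ 2 / s)) =ᶠ[𝓝 0] fun _ => 0 := by
    filter_upwards [Iio_mem_nhds hp] with s hs
    simp [h₁ s (le_of_lt hs)]
  have ht : Tendsto (fun s => a * (W s ^ 2 / s)) atTop (𝓝 0) := by
    refine tendsto_const_nhds.congr' ?_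
    filter_upwards [eventually_ge_atTop q] with s hs
    simp [h₂ s hs]
  rw [integral_Ioi_of_hasDerivAt_of_tendsto
    (continuousAt_const.congr h0.symm).continuousWithinAt hd hint ht]
  simp

end Energy

/-- Subtracting the derivative of (1-ν)/2 · W²/s, whose integral vanishes by compact support, leaves
the square of the part of W' that contains h'. The change of variable t = s^ν then gives the
right-hand side. -/
theorem integral_logProfile_energy {ν p q : ℝ} {h : ℝ → ℝ} (hν : 0 < ν) (hp : 0 < p) (hpq : p < q)
    (hh : ContDiff ℝ (⊤ : ℕ∞) h) (h₁ : ∀ t ≤ p, h t = 0) (h₂ : ∀ t, q ≤ t → h t = 0) :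
    ∫ s in Ioi 0, (deriv (logProfile ν h) s ^ 2 +
      (ν ^ 2 - 1) / 4 * (logProfile ν h s ^ 2 / s ^ 2)) = ν * ∫ t in Ioi 0, deriv h t ^ 2 := by
  set W := logProfile ν h
  have hW := contDiff_logProfile hν hp h₁ hh
  obtain ⟨hint, hzero⟩ := integral_deriv_sq_div_eq_zero ((1 - ν) / 2) hW
    (Real.rpow_pos_of_pos hp _) (fun s hs => logProfile_eq_zero_of_le hν hp h₁ hs)
    (fun s hs => logProfile_eq_zero_of_ge hν (hp.trans hpq) h₂ hs)
  have hint' := integrableOn_energy ((ν ^ 2 - 1) / 4) hW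
    (Real.rpow_pos_of_pos hp _) (fun s hs => logProfile_eq_zero_of_le hν hp h₁ hs)
    (fun s hs => logProfile_eq_zero_of_ge hν (hp.trans hpq) h₂ hs)
  have hsub := integral_sub hint' hint
  rw [hzero, sub_zero] at hsub
  rw [← integral_comp_rpow_Ioi_of_pos (g := fun t => deriv h t ^ 2) hν, ← integral_const_mul,
    ← hsub]
  refine setIntegral_congr_fun measurableSet_Ioi fun s (hs : 0 < s) => ?_
  have e1 : s ^ (ν - 1) = (s ^ ((1 - ν) / 2) * s ^ (ν - 1)) ^ 2 := by
    rw [← Real.rpow_add hs, ← Real.rpow_natCast, ← Real.rpow_mul hs.le]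
    congr 1; push_cast; ring
  have hd := (hasDerivAt_logProfile (ν := ν) (hh.differentiable (by simp)) hs).deriv
  rw [hd]
  simp only [smul_eq_mul]
  set V := s ^ ((1 - ν) / 2) * (deriv h (s ^ ν) * (ν * s ^ (ν - 1)))
  have hV : ν * (ν * s ^ (ν - 1) * deriv h (s ^ ν) ^ 2) = V ^ 2 := by
    rw [e1]; simp only [V]; ring
  rw [hV]
  change ((1 - ν) / 2 * W s / s + V) ^ 2 + (ν ^ 2 - 1) / 4 * (W s ^ 2 / s ^ 2) -
    (1 - ν) / 2 * ((2 * W s * ((1 - ν) / 2 * W s / s + V) * s - W s ^ 2) / s ^ 2) = V ^ 2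
  field_simp
  ring

/-! ### Radial test functions and their dilations. -/

section RadialTest

variable {W : ℝ → ℝ} {p q : ℝ}

/-- Vanishing of W for large s makes the function zero near the origin, where the norm is not
smooth; vanishing for s ≤ p keeps its support inside the disc. -/
lemma exists_radial_test (hW : ContDiff ℝ (⊤ : ℕ∞) W) (hp : 0 < p)
    (h₁ : ∀ s ≤ p, W s = 0) (h₂ : ∀ s, q ≤ s → W s = 0) :
    ∃ φ : 𝓓(unitDisc, ℝ), ∀ x, φ x = W (-Real.log ‖x‖) := by
  have hzero : ∀ x : Plane, x ∉ Metric.closedBall (0 : Plane) (Real.exp (-p)) →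
      W (-Real.log ‖x‖) = 0 := by
    intro x hx
    rw [mem_closedBall_zero_iff, not_le] at hx
    refine h₁ _ ?_
    have := (Real.lt_log_iff_exp_lt ((Real.exp_pos _).trans hx)).2 hx
    linarith
  have hcd : ContDiff ℝ (⊤ : ℕ∞) fun x : Plane => W (-Real.log ‖x‖) := by
    rw [contDiff_iff_contDiffAt]
    intro x
    by_cases hx : x = 0
    · have h0 : (fun x : Plane => W (-Real.log ‖x‖)) =ᶠ[𝓝 x] fun _ => 0 := by
        rw [hx]
        filter_upwards [Metric.ball_mem_nhds (0 : Plane) (Real.exp_pos (-q))] with y hy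
        by_cases hy0 : y = 0
        · simp [hy0, h₁ 0 hp.le]
        · rw [mem_ball_zero_iff] at hy
          refine h₂ _ ?_
          have := (Real.log_lt_iff_lt_exp (norm_pos_iff.2 hy0)).2 hy
          linarith
      exact contDiffAt_const.congr_of_eventuallyEq h0
    · exact hW.contDiffAt.comp x
        (((contDiffAt_norm ℝ hx).log (norm_ne_zero_iff.2 hx)).neg)
  refine ⟨⟨fun x => W (-Real.log ‖x‖), hcd,
    HasCompactSupport.intro (isCompact_closedBall 0 (Real.exp (-p))) hzero, ?_⟩, fun x => rfl⟩
  refine (closure_minimal (fun x hx => ?_) Metric.isClosed_closedBall).trans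
    (Metric.closedBall_subset_ball (ε₁ := Real.exp (-p)) (by simpa using hp))
  by_contra hc
  exact hx (hzero x hc)

lemma sq_testNorm_radial_le {μ : ℝ} (hμ : -(1 / 4 : ℝ) < μ) (hW : ContDiff ℝ (⊤ : ℕ∞) W)
    (hp : 0 < p) (h₁ : ∀ s ≤ p, W s = 0) (h₂ : ∀ s, q ≤ s → W s = 0)
    {φ : 𝓓(unitDisc, ℝ)} (hφ : ∀ x, φ x = W (-Real.log ‖x‖)) :
    testNorm μ φ ^ 2 ≤
      2 * Real.pi * ∫ s in Ioi 0, (deriv W s ^ 2 + μ * (W s ^ 2 / s ^ 2)) := by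
  rw [sq_testNorm φ hμ, integral_energyDensity_eq]
  have hray : ∀ θ, rayEnergy μ φ θ ≤ ∫ s in Ioi 0, (deriv W s ^ 2 + μ * (W s ^ 2 / s ^ 2)) := by
    intro θ
    rw [rayEnergy, integral_expMeasure]
    refine setIntegral_mono_on
      ((integrable_expMeasure_iff _).1 (integrable_energyDensity_ray φ μ θ))
      (integrableOn_energy μ hW hp h₁ h₂) measurableSet_Ioi fun s (hs : 0 < s) => ?_
    have he := energyDensity_logPolar μ φ (θ, s)
    dsimp only at he
    rw [he, hφ (logPolar (θ, s)), norm_logPolar, Real.log_exp, neg_neg]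
    refine add_le_add ?_ le_rfl
    have hne : logPolar (θ, s) ≠ 0 := by
      rw [← norm_ne_zero_iff, norm_logPolar]
      exact (Real.exp_pos _).ne'
    have hn : DifferentiableAt ℝ (fun x : Plane => ‖x‖) (logPolar (θ, s)) :=
      (contDiffAt_norm (n := 1) ℝ hne).differentiableAt (by simp)
    have hWd : HasDerivAt W (deriv W s) (-Real.log ‖logPolar (θ, s)‖) := by
      rw [norm_logPolar, Real.log_exp, neg_neg]
      exact (hW.differentiable (by simp) s).hasDerivAt
    have hfd := HasDerivAt.comp_hasFDerivAt (f := fun x : Plane => -Real.log ‖x‖)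
      (logPolar (θ, s)) hWd (hn.hasFDerivAt.log (norm_ne_zero_iff.2 hne)).neg
    have hφ' : (φ : Plane → ℝ) = W ∘ fun x => -Real.log ‖x‖ := funext hφ
    rw [hφ', hfd.fderiv, norm_smul, norm_neg, norm_smul, norm_fderiv_norm hn, norm_inv, norm_norm,
      norm_logPolar, mul_one, mul_pow, Real.norm_eq_abs, sq_abs, ← Real.exp_neg, neg_neg,
      ← Real.exp_nat_mul, mul_left_comm, ← Real.exp_add]
    simp
  calc ∫ θ, rayEnergy μ φ θ ∂circleMeasure
      ≤ ∫ _ : Metric.sphere (0 : Plane) 1,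
          (∫ s in Ioi 0, (deriv W s ^ 2 + μ * (W s ^ 2 / s ^ 2))) ∂circleMeasure :=
        integral_mono (integrable_rayEnergy φ μ) (integrable_const _) hray
    _ = _ := by
        rw [integral_const, measureReal_def, circleMeasure_univ,
          ENNReal.toReal_ofReal Real.two_pi_pos.le, smul_eq_mul]

end RadialTest

lemma testNorm_zero (μ : ℝ) : testNorm μ 0 = 0 := by
  have h : ∀ x, energyDensity μ (0 : 𝓓(unitDisc, ℝ)) x = 0 := by
    intro x
    simp [energyDensity, FunLike.coe_zero, norm_gradient]
  rw [testNorm_eq, integral_congr_ae (.of_forall h)]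
  simp

/-- A radial test function of norm at most one is admissible in the supremum. -/
lemma exists_mem_radialLeraySpace_of_test {μ : ℝ} {W : ℝ → ℝ} (hW : Measurable W)
    {φ : 𝓓(unitDisc, ℝ)} (hφ : ∀ x, φ x = W (-Real.log ‖x‖)) (h1 : testNorm μ φ ≤ 1) :
    ∃ u : Lp ℝ 2 discMeasure, (u ∈ radialLeraySpace μ ∧ lerayNorm μ u ≤ 1) ∧
      u =ᵐ[discMeasure] φ := by
  have hm : MemLp φ 2 discMeasure :=
    (φ.continuous.memLp_of_hasCompactSupport φ.hasCompactSupport).restrict _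
  have hrep : Represents μ (fun _ => φ) (hm.toLp φ) := by
    refine ⟨fun ε hε => ⟨0, fun _ _ _ _ => ?_⟩, ?_⟩
    · rw [sub_self, testNorm_zero]
      exact hε
    · have : eLpNorm (fun x => φ x - hm.toLp φ x) 2 discMeasure = 0 := by
        rw [eLpNorm_congr_ae (g := fun _ => (0 : ℝ))]
        · simp
        · filter_upwards [hm.coeFn_toLp] with x hx
          rw [hx, sub_self]
      simp only [this]
      exact tendsto_const_nhds
  refine ⟨hm.toLp φ, ⟨⟨⟨_, hrep⟩, fun r => W (-Real.log r), by fun_prop, ?_⟩, ?_⟩, hm.coeFn_toLp⟩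
  · filter_upwards [hm.coeFn_toLp] with x hx
    rw [hx, hφ]
  · refine le_trans (csInf_le ⟨0, ?_⟩ ?_) h1
    · rintro c ⟨ψ, -, hc⟩
      exact ge_of_tendsto' hc fun _ => Real.sqrt_nonneg _
    · exact ⟨_, hrep, tendsto_const_nhds⟩

lemma expIntegral_radial {α : ℝ} {W : ℝ → ℝ} (hW : Measurable W) {φ : 𝓓(unitDisc, ℝ)}
    (hφ : ∀ x, φ x = W (-Real.log ‖x‖)) {u : Lp ℝ 2 discMeasure} (hu : u =ᵐ[discMeasure] φ) :
    expIntegral α u = ENNReal.ofReal (2 * Real.pi) *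
      ∫⁻ s in Ioi 0, ENNReal.ofReal (Real.exp (α * W s ^ 2 - 2 * s)) := by
  calc expIntegral α u
      = ∫⁻ x, ENNReal.ofReal (Real.exp (α * W (-Real.log ‖x‖) ^ 2)) ∂discMeasure := by
        refine lintegral_congr_ae ?_
        filter_upwards [hu] with x hx
        rw [hx, hφ]
    _ = ∫⁻ _ : Metric.sphere (0 : Plane) 1, (∫⁻ s in Ioi 0, ENNReal.ofReal
          (Real.exp (α * W s ^ 2 - 2 * s))) ∂circleMeasure := by
        rw [lintegral_disc _ (by fun_prop)]
        refine lintegral_congr fun θ => ?_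
        simp only [norm_logPolar, Real.log_exp, neg_neg]
        rw [lintegral_expMeasure _ (by fun_prop)]
        refine lintegral_congr fun s => ?_
        rw [← ENNReal.ofReal_mul (Real.exp_nonneg _), ← Real.exp_add]
        congr 2
        ring
    _ = _ := by
        rw [lintegral_const, circleMeasure_univ, mul_comm]

/-- In the variable t = s^ν, the dilation √T w(s/T) is a dilation of h by T^ν with amplitude
T^{ν/2}. -/
lemma logProfile_dilation {ν : ℝ} {h : ℝ → ℝ} (A : ℝ) {T s : ℝ} (hT : 0 < T)
    (hs : 0 < s) :
    logProfile ν (fun t => A * T ^ (ν / 2) * h ((T ^ ν)⁻¹ * t)) (T * s) =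
      Real.sqrt T * (A * logProfile ν h s) := by
  rw [logProfile_of_pos (mul_pos hT hs), logProfile_of_pos hs, Real.mul_rpow hT.le hs.le,
    Real.mul_rpow hT.le hs.le, inv_mul_cancel_left₀ (Real.rpow_pos_of_pos hT _).ne',
    Real.sqrt_eq_rpow, show (1 / 2 : ℝ) = (1 - ν) / 2 + ν / 2 by ring, Real.rpow_add hT]
  ring

theorem iSup_expIntegral_supercritical_eq_top {μ : ℝ} (hμ : -(1 / 4 : ℝ) < μ) {α : ℝ}
    (hα : 4 * Real.pi * Real.sqrt (1 + 4 * μ) < α) :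
    (⨆ u ∈ {u | u ∈ radialLeraySpace μ ∧ lerayNorm μ u ≤ 1}, expIntegral α u) = ∞ := by
  set ν := Real.sqrt (1 + 4 * μ)
  have hν : 0 < ν := Real.sqrt_pos.2 (by linarith)
  have hμν : ν ^ 2 = 1 + 4 * μ := Real.sq_sqrt (by linarith)
  have hμ' : (ν ^ 2 - 1) / 4 = μ := by rw [hμν]; ring
  have hcrit : 0 < 4 * Real.pi * ν := by positivity
  have hα0 : 0 < α := hcrit.trans hα
  -- With this η the factor 1 - η is 4πν/α, so the profile satisfies 4πνJ < αh(1)².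
  obtain ⟨h, p, q, J, hh, hp, hpq, h₁, h₂, hJ, hJle, hJlt⟩ := exists_smooth_profile
    (η := 1 - 4 * Real.pi * ν / α) (by rw [sub_pos, div_lt_one hα0]; exact hα)
    (by have : 0 < 4 * Real.pi * ν / α := by positivity
        linarith)
  -- Normalizes the energy bound 2πνJ to 1.
  set A := (Real.sqrt (2 * Real.pi * ν * J))⁻¹
  have hA : A ^ 2 * (2 * Real.pi * ν * J) = 1 := by
    rw [inv_pow, Real.sq_sqrt (by positivity)]
    exact inv_mul_cancel₀ (by positivity)
  set W₁ := logProfile ν h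
  have hW₁ : ContDiff ℝ (⊤ : ℕ∞) W₁ := contDiff_logProfile hν hp h₁ hh
  have hpos : 0 < α * (A * W₁ 1) ^ 2 - 2 * 1 := by
    have e1 : W₁ 1 = h 1 := by simp [W₁, logProfile]
    have e2 : 4 * Real.pi * ν * J < α * h 1 ^ 2 := by
      rw [sub_sub_cancel, div_mul_eq_mul_div, div_lt_iff₀ hα0] at hJlt
      linarith
    rw [e1]
    have hA2 : 0 < A ^ 2 := by positivity
    nlinarith
  obtain ⟨δ, hδ, hδpos⟩ := exists_between hpos
  have hWc : Continuous W₁ := hW₁.continuous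
  have hev : ∀ᶠ s in 𝓝 (1 : ℝ), δ < α * (A * W₁ s) ^ 2 - 2 * s :=
    Continuous.continuousAt (by fun_prop) |>.eventually (lt_mem_nhds hδpos)
  obtain ⟨r, hr, hball⟩ := Metric.eventually_nhds_iff_ball.1 hev
  refine ENNReal.eq_top_of_forall_nnreal_le fun K => ?_
  -- Chosen so that 2πTr ≥ K; the 1 keeps T positive when K = 0.
  set T : ℝ := max 1 (K / (2 * Real.pi * r))
  have hT : 0 < T := lt_max_of_lt_left one_pos
  set Λ := T ^ ν
  have hΛ : 0 < Λ := Real.rpow_pos_of_pos hT _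
  set B := A * T ^ (ν / 2)
  have hB : B ^ 2 = A ^ 2 * Λ := by
    rw [mul_pow, ← Real.rpow_natCast (T ^ (ν / 2)), ← Real.rpow_mul hT.le]
    norm_num [Λ]
  set g : ℝ → ℝ := fun t => B * h (Λ⁻¹ * t)
  have hg : ContDiff ℝ (⊤ : ℕ∞) g := by fun_prop
  have hg₁ : ∀ t ≤ Λ * p, g t = 0 := by
    intro t ht
    simp only [g]
    rw [h₁ _ (by rwa [inv_mul_le_iff₀ hΛ]), mul_zero]
  have hg₂ : ∀ t, Λ * q ≤ t → g t = 0 := by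
    intro t ht
    simp only [g]
    rw [h₂ _ (by rwa [le_inv_mul_iff₀ hΛ]), mul_zero]
  have hΛp : 0 < Λ * p := by positivity
  have hΛpq : Λ * p < Λ * q := by gcongr
  have hgJ : ∫ t in Ioi 0, deriv g t ^ 2 ≤ A ^ 2 * J := by
    have hd : ∀ t, deriv g t ^ 2 = B ^ 2 * (Λ⁻¹) ^ 2 * deriv h (Λ⁻¹ * t) ^ 2 := by
      intro t
      have := ((hh.differentiable (by simp) (Λ⁻¹ * t)).hasDerivAt.comp t
        ((hasDerivAt_id t).const_mul Λ⁻¹)).const_mul B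
      have h3 : deriv g t = B * (deriv h (Λ⁻¹ * t) * (Λ⁻¹ * 1)) := this.deriv
      rw [h3]; ring
    simp_rw [hd]
    rw [integral_const_mul, integral_comp_mul_left_Ioi (fun t => deriv h t ^ 2) 0 (inv_pos.2 hΛ),
      mul_zero, inv_inv, smul_eq_mul, hB]
    calc _ = A ^ 2 * ∫ t in Ioi 0, deriv h t ^ 2 := by field_simp
      _ ≤ _ := by gcongr
  set W := logProfile ν g
  have hW : ContDiff ℝ (⊤ : ℕ∞) W := contDiff_logProfile hν hΛp hg₁ hg
  have hW₁' := fun s hs => logProfile_eq_zero_of_le (s := s) hν hΛp hg₁ hs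
  have hW₂' := fun s hs => logProfile_eq_zero_of_ge (s := s) hν (hΛp.trans hΛpq) hg₂ hs
  obtain ⟨φ, hφ⟩ := exists_radial_test hW (Real.rpow_pos_of_pos hΛp _) hW₁' hW₂'
  have hnorm : testNorm μ φ ≤ 1 := by
    have h3 := sq_testNorm_radial_le hμ hW (Real.rpow_pos_of_pos hΛp _) hW₁' hW₂' hφ
    have h4 := integral_logProfile_energy hν hΛp hΛpq hg hg₁ hg₂
    rw [hμ'] at h4
    rw [h4] at h3
    have h5 : testNorm μ φ ^ 2 ≤ 1 := by
      refine h3.trans (le_of_le_of_eq ?_ hA)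
      calc _ ≤ 2 * Real.pi * (ν * (A ^ 2 * J)) := by gcongr
        _ = _ := by ring
    exact (sq_le_one_iff₀ (Real.sqrt_nonneg _)).1 h5
  obtain ⟨u, hu, huφ⟩ := exists_mem_radialLeraySpace_of_test hW.continuous.measurable hφ hnorm
  refine le_trans ?_ (le_iSup₂_of_le u hu le_rfl)
  rw [expIntegral_radial hW.continuous.measurable hφ huφ]
  have hlow : ENNReal.ofReal (T * r) ≤
      ∫⁻ s in Ioi 0, ENNReal.ofReal (Real.exp (α * W s ^ 2 - 2 * s)) := by
    calc ENNReal.ofReal (T * r) = ∫⁻ _ in Ioo T (T * (1 + r)), 1 := by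
          rw [setLIntegral_one, Real.volume_Ioo]
          congr 1; ring
      _ ≤ ∫⁻ s in Ioo T (T * (1 + r)), ENNReal.ofReal (Real.exp (α * W s ^ 2 - 2 * s)) := by
          refine setLIntegral_mono' measurableSet_Ioo fun s hs => ?_
          -- At s = Tσ the exponent is T times its value at σ for the undilated profile, which is
          -- positive for σ near 1; so the integrand is at least 1.
          obtain ⟨σ, rfl⟩ : ∃ σ, s = T * σ := ⟨T⁻¹ * s, by field_simp⟩
          have hσ1 : 1 < σ := by
            have := hs.1
            nlinarith
          have hσ2 : σ < 1 + r := lt_of_mul_lt_mul_left hs.2 hT.le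
          have h6 := hball σ (by
            rw [Metric.mem_ball, Real.dist_eq, abs_of_pos (by linarith)]
            linarith)
          have h7 : W (T * σ) = Real.sqrt T * (A * W₁ σ) :=
            logProfile_dilation A hT (by linarith)
          rw [ENNReal.one_le_ofReal, Real.one_le_exp_iff, h7, mul_pow, Real.sq_sqrt hT.le]
          nlinarith [mul_pos hT (hδ.trans h6)]
      _ ≤ _ := lintegral_mono_set fun s hs => hT.trans hs.1
  calc (K : ℝ≥0∞) ≤ ENNReal.ofReal (2 * Real.pi) * ENNReal.ofReal (T * r) := by
        rw [← ENNReal.ofReal_mul Real.two_pi_pos.le, ← ENNReal.ofReal_coe_nnreal]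
        apply ENNReal.ofReal_le_ofReal
        have : (K : ℝ) / (2 * Real.pi * r) ≤ T := le_max_right _ _
        rw [div_le_iff₀ (by positivity)] at this
        linarith
    _ ≤ _ := by gcongr

theorem theorem4p1 (μ : ℝ) (hμ : -(1 / 4 : ℝ) < μ) :
    (⨆ u ∈ {u | u ∈ radialLeraySpace μ ∧ lerayNorm μ u ≤ 1},
        expIntegral (4 * Real.pi * Real.sqrt (1 + 4 * μ)) u) < ∞ ∧
      ∀ α : ℝ, 4 * Real.pi * Real.sqrt (1 + 4 * μ) < α →
        (⨆ u ∈ {u | u ∈ radialLeraySpace μ ∧ lerayNorm μ u ≤ 1}, expIntegral α u) = ∞ :=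
  ⟨iSup_expIntegral_critical_lt_top hμ, fun _ hα => iSup_expIntegral_supercritical_eq_top hμ hα⟩
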